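/- **Model.** Let $n_t,n_r$ be nonnegative integers, $P_1,\dots,P_{n_t}>0$, $\eta_1,\dots,\eta_{n_t}\in\mathbb R$, $\sigma>0$, $x_{\mathrm p}\in\mathbb C$. One use of the channel is $\mathbf Y=\mathbf H\mathbf X+\mathbf Z$ with $\mathbf H=[\mathbf h_1,\dots,\mathbf h_{n_t}]$, and the receiver CSI is the received pilot $\mathbf Y_{\mathrm p}=(\mathbf Y_{\mathrm p,1},\dots,\mathbf Y_{\mathrm p,n_t})$, $\mathbf Y_{\mathrm p,i}=\mathbf h_i x_{\mathrm p}+\mathbf Z_{\mathrm p,i}$. Here $\mathbf h_i\sim\mathcal{CN}(\mathbf 0,\eta_i^2\mathbf I_{n_r})$, $\mathbf Z_{\mathrm p,i}\sim\mathcal{CN}(\mathbf 0,\sigma^2\mathbf I_{n_r})$, $X_i\sim\mathcal{CN}(0,P_i)$ ($1\le i\le n_t$) and $\mathbf Z\sim\mathcal{CN}(\mathbf 0,\sigma^2\mathbf I_{n_r})$ are all independent. Put $\mathbf K_x=\mathrm{diag}(P_1,\dots,P_{n_t})$. Write $^*$ for conjugate transpose and $\mathbf X^{i-1}=(X_1,\dots,X_{i-1})$;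 logarithms are natural. **Linear S-GNNDR.** A linear receiver consists of measurable functions $\beta_i,\gamma_i$ (with values in $\mathbb C^{n_r}$) and $f_i$ (with values in $\mathbb C$) of the CSI $\mathbf v$, $1\le i\le n_t$. It decodes substream $i$, given the previously decoded substreams, by minimizing over the codewords $x_i^N$ the metric $$D_i(x_i^N)=\frac1N\sum_{n=1}^N\bigl|g_i(\mathbf y_n,\mathbf v_n,\mathbf x_n^{i-1})-f_i(\mathbf v_n)x_{i,n}\bigr|^2,\qquad g_i(\mathbf y,\mathbf v,\mathbf x^{i-1})=\beta_i(\mathbf v)^*\Bigl(\mathbf y-\sum_{k<i}\gamma_k(\mathbf v)x_k\Bigr).$$ Its GMI for substream $i$, for the i.i.d. $\mathcal{CN}(0,P_i)$ codebook ensemble, is $$\sup_{\theta<0}\Bigl\{\theta\,\mathbf E\bigl[|g_i(\mathbf Y,\mathbf Y_{\mathrm p},\mathbf X^{i-1})-f_i(\mathbf Y_{\mathrm p})X_i|^2\bigr]-\Lambda_i(\theta)\Bigr\},\qquad \Lambda_i(\theta)=\lim_{N\to\infty}\frac1N\log\mathbf E\bigl[e^{N\theta D_i(\bar x^N)}\,\big|\,\underline{\mathbf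 Y},\underline{\mathbf V},\underline{\mathbf X}^{i-1}\bigr],$$ where $\bar x^N\sim\mathcal{CN}(\mathbf 0,P_i\mathbf I_N)$ is independent of $\underline{\mathbf Y},\underline{\mathbf V},\underline{\mathbf X}^{i-1}$, which collect the outputs, CSI and first $i-1$ inputs of $N$ independent channel uses, and the limit is almost sure; only those $\theta$ count for which it exists and is finite, and the GMI is $-\infty$ if the expected metric of the transmitted symbol is infinite. Let $I^{(i)}_{\mathrm{GMI,lin}}$ be the supremum of the GMI of substream $i$ over all linear receivers, and $I^{\mathrm{sum}}_{\mathrm{GMI,lin}}=\sum_{i=1}^{n_t}I^{(i)}_{\mathrm{GMI,lin}}$. **Conventional scheme.** Let $\hat{\mathbf H}=\mathbf E[\mathbf H|\mathbf Y_{\mathrm p}]$ be the MMSE channel estimate, $\tilde{\mathbf H}=\mathbf H-\hat{\mathbf H}$, and write $\mathbf Y=\hat{\mathbf H}\mathbf X+\tilde{\mathbf Z}$ with overall noise $\tilde{\mathbf Z}=\tilde{\mathbf H}\mathbf X+\mathbf Z$. Let $\mathbf K_{\tilde z}=\mathbf E[\tilde{\mathbf H}\mathbf K_x\tilde{\mathbf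 H}^*+\mathbf Z\mathbf Z^*|\mathbf Y_{\mathrm p}]$. **Claim.** Let $$a_i=\frac{P_i\eta_i^4|x_{\mathrm p}|^2}{(\eta_i^2|x_{\mathrm p}|^2+\sigma^2)^2},\qquad b=\sum_{i=1}^{n_t}\frac{P_i\eta_i^2\sigma^2}{\eta_i^2|x_{\mathrm p}|^2+\sigma^2}+\sigma^2 .$$ Some linear receiver attains $I^{(i)}_{\mathrm{GMI,lin}}$ for all $i$ simultaneously. For each $i$, $$I^{(i)}_{\mathrm{GMI,lin}}=\mathbf E\Bigl[\log\Bigl(1+a_i\mathbf Y_{\mathrm p,i}^*\Bigl(\sum_{k>i}a_k\mathbf Y_{\mathrm p,k}\mathbf Y_{\mathrm p,k}^*+b\,\mathbf I_{n_r}\Bigr)^{-1}\mathbf Y_{\mathrm p,i}\Bigr)\Bigr],$$ and $$I^{\mathrm{sum}}_{\mathrm{GMI,lin}}=\mathbf E\Bigl[\log\det\Bigl(\mathbf I_{n_r}+\sum_{i=1}^{n_t}\frac{a_i}{b}\mathbf Y_{\mathrm p,i}\mathbf Y_{\mathrm p,i}^*\Bigr)\Bigr].$$ Moreover $\mathbf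 K_{\tilde z}=\mathbf E[\tilde{\mathbf Z}\tilde{\mathbf Z}^*|\mathbf Y_{\mathrm p}]=b\,\mathbf I_{n_r}$ almost surely, and $$I^{\mathrm{sum}}_{\mathrm{GMI,lin}}=\mathbf E\bigl[\log\det\bigl(\mathbf I_{n_r}+\mathbf K_{\tilde z}^{-1}\hat{\mathbf H}\mathbf K_x\hat{\mathbf H}^*\bigr)\bigr],$$ the rate of the conventional pilot-assisted scheme, which estimates $\mathbf H$ by $\hat{\mathbf H}$ and then uses the estimate for coherent decoding. All expectations of logarithms here are finite. -/

import Mathlib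

open MeasureTheory ProbabilityTheory Filter Topology
open scoped Matrix ComplexConjugate

noncomputable section

namespace SGNNDR

/-- The circularly symmetric complex Gaussian law `CN(0, v)`: independent real and imaginary
parts, each `N(0, v / 2)`. -/
def complexGaussian (v : ℝ) : Measure ℂ :=
  ((gaussianReal 0 (v / 2).toNNReal).prod (gaussianReal 0 (v / 2).toNNReal)).map
    Complex.measurableEquivRealProd.symm

instance (v : ℝ) : IsProbabilityMeasure (complexGaussian v) :=
  Measure.isProbabilityMeasure_map Complex.measurableEquivRealProd.symm.measurable.aemeasurable

/-- The alphabet of the receiver CSI: the tuple `(Y_{p,1}, …, Y_{p,nt})` of received pilot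
vectors in `ℂ^nr`. -/
abbrev CSI (nt nr : ℕ) := Fin nt → Fin nr → ℂ

/-- All scalar sources of randomness of one channel use, as one family: the entries of the fading
vectors `h i`, of the pilot noises `Zp i`, of the input `X`, and of the noise `Z`. -/
def primitives {Ω : Type*} {nt nr : ℕ} (h Zp : Ω → Fin nt → Fin nr → ℂ) (X : Ω → Fin nt → ℂ)
    (Z : Ω → Fin nr → ℂ) :
    (Fin nt × Fin nr) ⊕ (Fin nt × Fin nr) ⊕ Fin nt ⊕ Fin nr → Ω → ℂ
  | .inl p => fun ω => h ω p.1 p.2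
  | .inr (.inl p) => fun ω => Zp ω p.1 p.2
  | .inr (.inr (.inl i)) => fun ω => X ω i
  | .inr (.inr (.inr r)) => fun ω => Z ω r

/-- One use of the Rayleigh fading MIMO channel with `nt` transmit and `nr` receive antennas,
together with the pilot transmission, on the probability space `(Ω, μ)`. A vector has law
`CN(0, v I)` iff its entries are independent with law `CN(0, v)`. -/
structure PilotChannel {Ω : Type*} [MeasurableSpace Ω] (μ : Measure Ω) (nt nr : ℕ) where
  /-- powers `P_i` of the substreams -/
  P : Fin nt → ℝ
  P_pos : ∀ i, 0 < P i
  /-- fading standard deviations `η_i` -/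
  η : Fin nt → ℝ
  /-- noise standard deviation `σ` -/
  σ : ℝ
  σ_pos : 0 < σ
  /-- pilot symbol `x_p` -/
  xp : ℂ
  /-- fading vectors: `h ω i` is the `i`th column of `H` -/
  h : Ω → Fin nt → Fin nr → ℂ
  /-- noises of the received pilots -/
  Zp : Ω → Fin nt → Fin nr → ℂ
  /-- channel input -/
  X : Ω → Fin nt → ℂ
  /-- channel noise -/
  Z : Ω → Fin nr → ℂ
  measurable_h : Measurable h
  measurable_Zp : Measurable Zp
  measurable_X : Measurable X
  measurable_Z : Measurable Z
  law_h : ∀ i r, HasLaw (fun ω => h ω i r) (complexGaussian (η i ^ 2)) μ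
  law_Zp : ∀ i r, HasLaw (fun ω => Zp ω i r) (complexGaussian (σ ^ 2)) μ
  law_X : ∀ i, HasLaw (fun ω => X ω i) (complexGaussian (P i)) μ
  law_Z : ∀ r, HasLaw (fun ω => Z ω r) (complexGaussian (σ ^ 2)) μ
  indep : iIndepFun (primitives h Zp X Z) μ

/-! ### Generalized mutual information of a nearest neighbor decoding rule -/

section GMI

variable {Ω : Type*} [MeasurableSpace Ω]

/-- The accumulated metric `D = (1/N) ∑_n |g_n - f_n x_n|²` of the word `x`, where `g_n`, `f_n` are
the values of the processing and of the scaling function at the `n`th channel use. -/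
def metric {N : ℕ} (g f x : Fin N → ℂ) : ℝ :=
  (1 / (N : ℝ)) * ∑ n, ‖g n - f n * x n‖ ^ 2

/-- `Λ_N(t) = log E[exp (t D)]` for a codeword independent of the observations, with i.i.d.
entries of law `CN(0, p)`, conditionally on the observations (which enter through `g`, `f`). -/
def logMGF (p : ℝ) {N : ℕ} (g f : Fin N → ℂ) (t : ℝ) : ℝ :=
  Real.log (∫ x : Fin N → ℂ, Real.exp (t * metric g f x)
    ∂(Measure.pi fun _ : Fin N => complexGaussian p))

/-- `Λ(θ) = lim_N (1/N) Λ_N(N θ)` exists and equals `Λ`, almost surely over a sequence `ω` of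
independent channel uses, each distributed as `μ`. -/
def IsLimitLogMGF (μ : Measure Ω) (p : ℝ) (G F : Ω → ℂ) (θ Λ : ℝ) : Prop :=
  ∀ᵐ ω ∂(Measure.infinitePi fun _ : ℕ => μ),
    Tendsto (fun N : ℕ => (1 / (N : ℝ)) *
      logMGF p (fun n : Fin N => G (ω n)) (fun n : Fin N => F (ω n)) (N * θ)) atTop (𝓝 Λ)

/-- The generalized mutual information
`sup_{θ < 0} { θ E[|G - F X|²] - Λ(θ) }`
of the decoder with metric `|G - F x|²`, where `X` is the transmitted symbol and the codebook is
i.i.d. `CN(0, p)`. If the metric of the transmitted codeword has infinite mean, the supremum is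
over the empty set, so the decoder is assigned the value `-∞`. -/
def gmi (μ : Measure Ω) (p : ℝ) (G F X : Ω → ℂ) : EReal :=
  sSup {r : EReal | Integrable (fun ω => ‖G ω - F ω * X ω‖ ^ 2) μ ∧
    ∃ θ < (0 : ℝ), ∃ Λ : ℝ, IsLimitLogMGF μ p G F θ Λ ∧
      r = ((θ * (∫ ω, ‖G ω - F ω * X ω‖ ^ 2 ∂μ) - Λ : ℝ) : EReal)}

end GMI

/-- The coefficient functions of a successive decoder with linear processing functions
`g_i(y, v, x^{i-1}) = β_i(v)^* (y - ∑_{k < i} γ_k(v) x_k)` and with scaling functions `f_i(v)`. -/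
structure LinearReceiver (nt nr : ℕ) where
  β : Fin nt → CSI nt nr → Fin nr → ℂ
  γ : Fin nt → CSI nt nr → Fin nr → ℂ
  f : Fin nt → CSI nt nr → ℂ
  measurable_β : ∀ i, Measurable (β i)
  measurable_γ : ∀ i, Measurable (γ i)
  measurable_f : ∀ i, Measurable (f i)

/-- The linear processing function of the `i`th substream; `x` holds the previously decoded
symbols. -/
def LinearReceiver.g {nt nr : ℕ} (R : LinearReceiver nt nr) (i : Fin nt)
    (y : Fin nr → ℂ) (v : CSI nt nr) (x : Set.Iio i → ℂ) : ℂ :=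
  star (R.β i v) ⬝ᵥ (y - ∑ k : Set.Iio i, x k • R.γ k v)

namespace PilotChannel

variable {Ω : Type*} [MeasurableSpace Ω] {μ : Measure Ω} {nt nr : ℕ}

/-- Fading matrix, with columns `h_i`. -/
def H (C : PilotChannel μ nt nr) (ω : Ω) : Matrix (Fin nr) (Fin nt) ℂ :=
  Matrix.of fun r i => C.h ω i r

/-- Channel output `Y = H X + Z`. -/
def Y (C : PilotChannel μ nt nr) (ω : Ω) : Fin nr → ℂ :=
  C.H ω *ᵥ C.X ω + C.Z ω

/-- Received pilot signal `Y_{p,i} = h_i x_p + Z_{p,i}`, which is the receiver CSI. -/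
def Yp (C : PilotChannel μ nt nr) (ω : Ω) : CSI nt nr :=
  fun i => C.xp • C.h ω i + C.Zp ω i

/-- The σ-algebra generated by the received pilot signal. -/
@[reducible] def pilotSigma (C : PilotChannel μ nt nr) : MeasurableSpace Ω :=
  MeasurableSpace.comap C.Yp inferInstance

/-- GMI of the `i`th substream under the successive decoder with coefficients `R`. -/
def gmiOf (C : PilotChannel μ nt nr) (R : LinearReceiver nt nr) (i : Fin nt) : EReal :=
  gmi μ (C.P i)
    (fun ω => R.g i (C.Y ω) (C.Yp ω) (fun k => C.X ω k))
    (fun ω => R.f i (C.Yp ω))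
    (fun ω => C.X ω i)

/-- The optimized GMI of the `i`th substream over all linear decoders. -/
def gmiLin (C : PilotChannel μ nt nr) (i : Fin nt) : EReal :=
  ⨆ R : LinearReceiver nt nr, C.gmiOf R i

/-- The constants `a_i = P_i η_i⁴ |x_p|² / (η_i² |x_p|² + σ²)²`. -/
def a (C : PilotChannel μ nt nr) (i : Fin nt) : ℝ :=
  C.P i * C.η i ^ 4 * ‖C.xp‖ ^ 2 / (C.η i ^ 2 * ‖C.xp‖ ^ 2 + C.σ ^ 2) ^ 2

/-- The constant `b = ∑_i P_i η_i² σ² / (η_i² |x_p|² + σ²) + σ²`. -/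
def b (C : PilotChannel μ nt nr) : ℝ :=
  ∑ i, C.P i * C.η i ^ 2 * C.σ ^ 2 / (C.η i ^ 2 * ‖C.xp‖ ^ 2 + C.σ ^ 2) + C.σ ^ 2

/-- The rank-one matrix `Y_{p,i} Y_{p,i}^*`. -/
def pilotOuter (C : PilotChannel μ nt nr) (i : Fin nt) (ω : Ω) : Matrix (Fin nr) (Fin nr) ℂ :=
  Matrix.vecMulVec (C.Yp ω i) (star (C.Yp ω i))

/-- `log (1 + a_i Y_{p,i}^* (∑_{k > i} a_k Y_{p,k} Y_{p,k}^* + b I)⁻¹ Y_{p,i})`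
(the argument is a real number). -/
def substreamInfo (C : PilotChannel μ nt nr) (i : Fin nt) (ω : Ω) : ℝ :=
  Real.log (1 + (C.a i : ℂ) * (star (C.Yp ω i) ⬝ᵥ
    ((∑ k ∈ Finset.Ioi i, (C.a k : ℂ) • C.pilotOuter k ω
      + (C.b : ℂ) • (1 : Matrix (Fin nr) (Fin nr) ℂ))⁻¹ *ᵥ C.Yp ω i))).re

/-- `log det (I + ∑_i (a_i / b) Y_{p,i} Y_{p,i}^*)` (the determinant is a positive real). -/
def sumInfo (C : PilotChannel μ nt nr) (ω : Ω) : ℝ :=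
  Real.log (1 + ∑ i, ((C.a i / C.b : ℝ) : ℂ) • C.pilotOuter i ω).det.re

/-- Input covariance matrix `K_x = diag(P_1, …, P_nt)`. -/
def Kx (C : PilotChannel μ nt nr) : Matrix (Fin nt) (Fin nt) ℂ :=
  Matrix.diagonal fun i => (C.P i : ℂ)

/-- The MMSE channel estimate `Ĥ = E[H | Y_p]`. -/
def Hhat (C : PilotChannel μ nt nr) (ω : Ω) : Matrix (Fin nr) (Fin nt) ℂ :=
  Matrix.of fun r i => (μ[fun ω' => C.H ω' r i | C.pilotSigma]) ω

/-- The channel estimation error `H̃ = H - Ĥ`. -/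
def Htilde (C : PilotChannel μ nt nr) (ω : Ω) : Matrix (Fin nr) (Fin nt) ℂ :=
  C.H ω - C.Hhat ω

/-- The overall noise `Z̃ = H̃ X + Z`, so that `Y = Ĥ X + Z̃`. -/
def Ztilde (C : PilotChannel μ nt nr) (ω : Ω) : Fin nr → ℂ :=
  C.Htilde ω *ᵥ C.X ω + C.Z ω

/-- `K_z̃ = E[H̃ K_x H̃^* + Z Z^* | Y_p]`. -/
def Kz (C : PilotChannel μ nt nr) (ω : Ω) : Matrix (Fin nr) (Fin nr) ℂ :=
  Matrix.of fun r s => (μ[fun ω' => (C.Htilde ω' * C.Kx * (C.Htilde ω')ᴴ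
    + Matrix.vecMulVec (C.Z ω') (star (C.Z ω'))) r s | C.pilotSigma]) ω

/-- The conditional covariance `E[Z̃ Z̃^* | Y_p]` of the overall noise. -/
def covZtilde (C : PilotChannel μ nt nr) (ω : Ω) : Matrix (Fin nr) (Fin nr) ℂ :=
  Matrix.of fun r s =>
    (μ[fun ω' => C.Ztilde ω' r * conj (C.Ztilde ω' s) | C.pilotSigma]) ω

/-- `log det (I + K_z̃⁻¹ Ĥ K_x Ĥ^*)`, the information density (given the received pilot) of the
conventional scheme, which estimates `H` by `Ĥ` and decodes coherently, treating `Z̃` as noise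
(the determinant is almost surely a positive real). -/
def conventionalInfo (C : PilotChannel μ nt nr) (ω : Ω) : ℝ :=
  Real.log (1 + (C.Kz ω)⁻¹ * C.Hhat ω * C.Kx * (C.Hhat ω)ᴴ).det.re

end PilotChannel

end SGNNDR

end

noncomputable section

namespace SGNNDR

/-! ### The complex Gaussian law -/

/-! Given the observations, the moment generating function of the metric factors over the channel
uses. Each factor is an explicit Gaussian integral with logarithm `symbolLogMGF`, so the law of
large numbers, with a converse for variables of constant sign, turns the GMI into the supremum over
`θ < 0` of the single-letter expression `θ E|G - F X|² - E[symbolLogMGF p θ G F]`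
(`isLimitLogMGF_iff`).

Next condition on the pilot. Write `h_k = c_k Y_{p,k} + err_k` with `c_k = mmseCoeff k`. Since
everything is jointly Gaussian, the uncorrelated error is independent of the pilot. Hence `Y = ∑ X_k
c_k Y_{p,k} + noise`, where the pair `(X, noise)` is independent of the pilot and has uncorrelated
entries with variances `P_k` and `b`. The noise is neither Gaussian nor independent of `X`, but for
a linear `g` and a quadratic metric only second moments enter. With `u` the gain of `X_i` and `s`
the residual power, the conditional second moments of the error and of `g` are `s + P_i |u - f|²`
and `s + P_i |u|²`.

For the upper bound, Cauchy–Schwarz (`norm_sq_dotProduct_le`) gives `P_i |u|² ≤ κ s` with `κ = a_i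
Y_{p,i}^* M⁻¹ Y_{p,i}`, `M` being the covariance of the undecoded interference plus noise. The
scalar inequality `rate_le` then bounds the integrand by `log (1 + κ)` pointwise in the CSI.
Equality holds at `θ = -1` for the MMSE filter with exact cancellation of decoded substreams, scaled
so that `s = 1`, and with `f = u`: scaling `β` and `f` by a function of the CSI makes one constant
`θ` optimal for every CSI value.

The determinant formula for rank-one updates telescopes the sum over substreams
(`sum_log_one_add_quality`). Finally `K_z̃ = b I` and `Ĥ K_x Ĥ^* = ∑ a_k Y_{p,k} Y_{p,k}^*`, so the
conventional information density equals the sum density almost surely. -/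

instance isGaussian_complexGaussian (v : ℝ) : IsGaussian (complexGaussian v) := by
  have h := isGaussian_map_equiv
    (μ := (gaussianReal 0 (v / 2).toNNReal).prod (gaussianReal 0 (v / 2).toNNReal))
    Complex.equivRealProdCLM.symm
  exact h

lemma integral_complexGaussian {E : Type*} [NormedAddCommGroup E] [NormedSpace ℝ E]
    (v : ℝ) (φ : ℂ → E) :
    ∫ z, φ z ∂(complexGaussian v) = ∫ q : ℝ × ℝ, φ ⟨q.1, q.2⟩
      ∂((gaussianReal 0 (v / 2).toNNReal).prod (gaussianReal 0 (v / 2).toNNReal)) := by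
  rw [complexGaussian, integral_map_equiv]
  rfl

lemma memLp_two_complexGaussian (v : ℝ) : MemLp (fun z : ℂ => z) 2 (complexGaussian v) :=
  IsGaussian.memLp_id _ 2 (by norm_num)

lemma integrable_complexGaussian (v : ℝ) : Integrable (fun z : ℂ => z) (complexGaussian v) :=
  (memLp_two_complexGaussian v).integrable (by norm_num)

lemma integral_re_complexGaussian (v : ℝ) : ∫ z : ℂ, z.re ∂(complexGaussian v) = 0 := by
  rw [integral_complexGaussian]
  have := integral_fun_fst (μ := gaussianReal 0 (v / 2).toNNReal)
    (ν := gaussianReal 0 (v / 2).toNNReal) (fun x : ℝ => x)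
  simpa using this

lemma integral_im_complexGaussian (v : ℝ) : ∫ z : ℂ, z.im ∂(complexGaussian v) = 0 := by
  rw [integral_complexGaussian]
  have := integral_fun_snd (μ := gaussianReal 0 (v / 2).toNNReal)
    (ν := gaussianReal 0 (v / 2).toNNReal) (fun x : ℝ => x)
  simpa using this

lemma integral_id_complexGaussian (v : ℝ) : ∫ z : ℂ, z ∂(complexGaussian v) = 0 := by
  have h := integral_re_add_im (𝕜 := ℂ) (integrable_complexGaussian v)
  simpa [integral_re_complexGaussian, integral_im_complexGaussian] using h.symm

lemma integral_sq_gaussianReal (v : NNReal) : ∫ x : ℝ, x ^ 2 ∂(gaussianReal 0 v) = v := by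
  have h := variance_fun_id_gaussianReal (μ := 0) (v := v)
  rw [variance_eq_integral (by fun_prop)] at h
  simpa using h

lemma integral_re_sq_complexGaussian {v : ℝ} (hv : 0 ≤ v) :
    ∫ z : ℂ, z.re ^ 2 ∂(complexGaussian v) = v / 2 := by
  rw [integral_complexGaussian]
  have := integral_fun_fst (μ := gaussianReal 0 (v / 2).toNNReal)
    (ν := gaussianReal 0 (v / 2).toNNReal) (fun x : ℝ => x ^ 2)
  simpa [integral_sq_gaussianReal, max_eq_left (div_nonneg hv zero_le_two)] using this

lemma integral_im_sq_complexGaussian {v : ℝ} (hv : 0 ≤ v) :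
    ∫ z : ℂ, z.im ^ 2 ∂(complexGaussian v) = v / 2 := by
  rw [integral_complexGaussian]
  have := integral_fun_snd (μ := gaussianReal 0 (v / 2).toNNReal)
    (ν := gaussianReal 0 (v / 2).toNNReal) (fun x : ℝ => x ^ 2)
  simpa [integral_sq_gaussianReal, max_eq_left (div_nonneg hv zero_le_two)] using this

lemma integral_re_mul_im_complexGaussian (v : ℝ) :
    ∫ z : ℂ, z.re * z.im ∂(complexGaussian v) = 0 := by
  rw [integral_complexGaussian]
  have := integral_prod_mul (μ := gaussianReal 0 (v / 2).toNNReal)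
    (ν := gaussianReal 0 (v / 2).toNNReal) (fun x : ℝ => x) (fun x : ℝ => x)
  simpa using this

lemma integrable_re_sq_complexGaussian (v : ℝ) :
    Integrable (fun z : ℂ => z.re ^ 2) (complexGaussian v) :=
  (memLp_two_complexGaussian v).re.integrable_sq

lemma integrable_im_sq_complexGaussian (v : ℝ) :
    Integrable (fun z : ℂ => z.im ^ 2) (complexGaussian v) :=
  (memLp_two_complexGaussian v).im.integrable_sq

lemma integral_mul_self_complexGaussian {v : ℝ} (hv : 0 ≤ v) :
    ∫ z : ℂ, z * z ∂(complexGaussian v) = 0 := by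
  have hL := memLp_two_complexGaussian v
  have h := integral_re_add_im (𝕜 := ℂ) (hL.integrable_mul hL)
  simp only [Pi.mul_apply, RCLike.mul_re, RCLike.mul_im] at h
  rw [← h]
  have h1 : ∫ z : ℂ, (z.re * z.re - z.im * z.im) ∂(complexGaussian v) = 0 := by
    simp only [← pow_two]
    rw [integral_sub (integrable_re_sq_complexGaussian v) (integrable_im_sq_complexGaussian v),
      integral_re_sq_complexGaussian hv, integral_im_sq_complexGaussian hv, sub_self]
  have h2 : ∫ z : ℂ, (z.re * z.im + z.im * z.re) ∂(complexGaussian v) = 0 := by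
    have : (fun z : ℂ => z.re * z.im + z.im * z.re) = fun z => 2 * (z.re * z.im) := by
      ext z; ring
    rw [this, integral_const_mul, integral_re_mul_im_complexGaussian, mul_zero]
  simp [h1, h2]

lemma integral_mul_conj_complexGaussian {v : ℝ} (hv : 0 ≤ v) :
    ∫ z : ℂ, z * conj z ∂(complexGaussian v) = v := by
  have h : (fun z : ℂ => z * conj z) = fun z => ((z.re ^ 2 + z.im ^ 2 : ℝ) : ℂ) := by
    ext z
    rw [Complex.mul_conj, Complex.normSq_apply]
    ring_nf
  rw [h, integral_complex_ofReal,
    integral_add (integrable_re_sq_complexGaussian v) (integrable_im_sq_complexGaussian v),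
    integral_re_sq_complexGaussian hv, integral_im_sq_complexGaussian hv, add_halves]

/-- Completing the square: the integrand times the Gaussian density is a constant multiple of
another Gaussian density, which integrates to one. -/
lemma integral_exp_neg_mul_sq_gaussianReal {v : NNReal} (hv : v ≠ 0) {t : ℝ} (ht : 0 ≤ t)
    (m : ℝ) :
    ∫ x : ℝ, Real.exp (-t * (m - x) ^ 2) ∂(gaussianReal 0 v) =
      (√(1 + 2 * t * v))⁻¹ * Real.exp (-t * m ^ 2 / (1 + 2 * t * v)) := by
  have hv0 : (0 : ℝ) < v := by positivity
  have hd : (0 : ℝ) < 1 + 2 * t * v := by positivity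
  rw [integral_gaussianReal_eq_integral_smul hv]
  -- The variance of the tilted Gaussian: the precisions add, `1 / w = 1 / v + 2 t`.
  set w : NNReal := ⟨v / (1 + 2 * t * v), by positivity⟩ with hw
  have hwv : (w : ℝ) = v / (1 + 2 * t * v) := rfl
  have hw0 : w ≠ 0 := by
    have : (0 : ℝ) < w := by rw [hwv]; positivity
    exact fun h => by simp [h] at this
  have key : ∀ x : ℝ, gaussianPDFReal 0 v x • Real.exp (-t * (m - x) ^ 2) =
      ((√(1 + 2 * t * v))⁻¹ * Real.exp (-t * m ^ 2 / (1 + 2 * t * v))) *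
        gaussianPDFReal (2 * t * m * w) w x := by
    intro x
    simp only [gaussianPDFReal, smul_eq_mul]
    have h1 : (√(2 * Real.pi * v))⁻¹ =
        (√(1 + 2 * t * v))⁻¹ * (√(2 * Real.pi * w))⁻¹ := by
      rw [← mul_inv, ← Real.sqrt_mul hd.le, hwv]
      congr 2
      field_simp
    have h2 : -(x - 0) ^ 2 / (2 * v) + -t * (m - x) ^ 2 =
        -t * m ^ 2 / (1 + 2 * t * v) + -(x - 2 * t * m * w) ^ 2 / (2 * w) := by
      rw [hwv]
      field_simp
      ring
    rw [mul_assoc, ← Real.exp_add, h2, Real.exp_add, h1]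
    ring
  simp_rw [key]
  rw [integral_const_mul, integral_gaussianPDFReal_eq_one _ hw0, mul_one]

/-- The Laplace transform of the squared distance between a point and a scaled complex Gaussian. -/
lemma integral_exp_mul_norm_sq_complexGaussian {p θ : ℝ} (hp : 0 < p) (hθ : θ < 0) (g f : ℂ) :
    ∫ x : ℂ, Real.exp (θ * ‖g - f * x‖ ^ 2) ∂(complexGaussian p) =
      Real.exp (θ * ‖g‖ ^ 2 / (1 - θ * p * ‖f‖ ^ 2)) / (1 - θ * p * ‖f‖ ^ 2) := by
  by_cases hf : f = 0
  · simp [hf]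
  have hf2 : 0 < ‖f‖ ^ 2 := by positivity
  set t : ℝ := -θ * ‖f‖ ^ 2 with ht
  have ht0 : 0 ≤ t := by rw [ht]; nlinarith
  have hpos : (0 : ℝ) < p / 2 := by positivity
  have hv : ((p / 2).toNNReal : ℝ) = p / 2 := Real.coe_toNNReal _ hpos.le
  have hv0 : (p / 2).toNNReal ≠ 0 := by simpa using hpos
  have hd : 1 - θ * p * ‖f‖ ^ 2 = 1 + 2 * t * ((p / 2).toNNReal : ℝ) := by rw [hv, ht]; ring
  have hd0 : 0 < 1 + 2 * t * ((p / 2).toNNReal : ℝ) := by positivity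
  rw [integral_complexGaussian]
  -- Factoring out `f` separates the real and imaginary coordinates of `g / f - x`; the two
  -- square-root normalizations then multiply to the full denominator.
  have h1 : ∀ q : ℝ × ℝ, Real.exp (θ * ‖g - f * (⟨q.1, q.2⟩ : ℂ)‖ ^ 2) =
      Real.exp (-t * ((g / f).re - q.1) ^ 2) * Real.exp (-t * ((g / f).im - q.2) ^ 2) := by
    intro q
    rw [← Real.exp_add]
    have : g - f * (⟨q.1, q.2⟩ : ℂ) = f * (g / f - ⟨q.1, q.2⟩) := by field_simp
    rw [this, norm_mul, mul_pow, Complex.sq_norm (g / f - _), Complex.normSq_apply]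
    simp only [Complex.sub_re, Complex.sub_im, ht]
    ring_nf
  simp_rw [h1]
  rw [integral_prod_mul (fun x : ℝ => Real.exp (-t * ((g / f).re - x) ^ 2))
    (fun x : ℝ => Real.exp (-t * ((g / f).im - x) ^ 2)),
    integral_exp_neg_mul_sq_gaussianReal hv0 ht0, integral_exp_neg_mul_sq_gaussianReal hv0 ht0,
    hd, mul_mul_mul_comm, ← mul_inv, Real.mul_self_sqrt hd0.le, ← Real.exp_add, ← add_div,
    div_eq_inv_mul (Real.exp _)]
  congr 3
  have hg : ‖g‖ ^ 2 = ‖f‖ ^ 2 * ((g / f).re ^ 2 + (g / f).im ^ 2) := by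
    have : g = f * (g / f) := by field_simp
    conv_lhs => rw [this, norm_mul, mul_pow, Complex.sq_norm (g / f), Complex.normSq_apply]
    ring
  rw [hg, ht]
  ring

/-! ### Evaluation of the generalized mutual information -/

/-- The logarithm of `E[exp (θ |g - f x|²)]` for `x` of law `CN(0, p)`. -/
def symbolLogMGF (p θ : ℝ) (g f : ℂ) : ℝ :=
  θ * ‖g‖ ^ 2 / (1 - θ * p * ‖f‖ ^ 2) - Real.log (1 - θ * p * ‖f‖ ^ 2)

lemma one_le_one_sub {p θ : ℝ} (hp : 0 < p) (hθ : θ < 0) (f : ℂ) : 1 ≤ 1 - θ * p * ‖f‖ ^ 2 := by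
  have : 0 ≤ (-θ) * p * ‖f‖ ^ 2 := by
    have := neg_pos.2 hθ
    positivity
  linarith

lemma neg_div_nonneg {p θ : ℝ} (hp : 0 < p) (hθ : θ < 0) (g f : ℂ) :
    0 ≤ -(θ * ‖g‖ ^ 2 / (1 - θ * p * ‖f‖ ^ 2)) := by
  have h1 := one_le_one_sub hp hθ f
  rw [← neg_div, ← neg_mul]
  have := neg_pos.2 hθ
  exact div_nonneg (by positivity) (by linarith)

lemma symbolLogMGF_nonpos {p θ : ℝ} (hp : 0 < p) (hθ : θ < 0) (g f : ℂ) :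
    symbolLogMGF p θ g f ≤ 0 := by
  have h1 := neg_div_nonneg hp hθ g f
  have h2 := Real.log_nonneg (one_le_one_sub hp hθ f)
  rw [symbolLogMGF]
  linarith

lemma measurable_symbolLogMGF {Ω : Type*} [MeasurableSpace Ω] (p θ : ℝ) {G F : Ω → ℂ}
    (hG : Measurable G) (hF : Measurable F) :
    Measurable fun ω => symbolLogMGF p θ (G ω) (F ω) := by
  unfold symbolLogMGF
  fun_prop

/-- The factor `N` in `N θ` cancels the `1 / N` of the metric, and the i.i.d. codeword makes the
expectation a product of one-symbol integrals. -/
lemma logMGF_eq_sum {p θ : ℝ} (hp : 0 < p) (hθ : θ < 0) {N : ℕ} (hN : N ≠ 0)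
    (g f : Fin N → ℂ) :
    logMGF p g f (N * θ) = ∑ n, symbolLogMGF p θ (g n) (f n) := by
  have hN' : (N : ℝ) ≠ 0 := by exact_mod_cast hN
  have h : ∀ x : Fin N → ℂ, Real.exp (N * θ * metric g f x) =
      ∏ n, Real.exp (θ * ‖g n - f n * x n‖ ^ 2) := by
    intro x
    rw [← Real.exp_sum, ← Finset.mul_sum, metric]
    congr 1
    field_simp
  rw [logMGF]
  simp_rw [h]
  rw [integral_fintype_prod_eq_prod (μ := fun _ : Fin N => complexGaussian p)
    (f := fun n x => Real.exp (θ * ‖g n - f n * x‖ ^ 2))]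
  simp_rw [integral_exp_mul_norm_sq_complexGaussian hp hθ]
  have hpos : ∀ n, 0 < 1 - θ * p * ‖f n‖ ^ 2 := fun n =>
    lt_of_lt_of_le one_pos (one_le_one_sub hp hθ (f n))
  rw [Real.log_prod fun n _ => (div_pos (Real.exp_pos _) (hpos n)).ne']
  refine Finset.sum_congr rfl fun n _ => ?_
  rw [Real.log_div (Real.exp_pos _).ne' (hpos n).ne', Real.log_exp, symbolLogMGF]

/-- The strong law of large numbers for i.i.d. sequences on the canonical space. -/
lemma tendsto_average_infinitePi {Ω : Type*} [MeasurableSpace Ω] (μ : Measure Ω)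
    [IsProbabilityMeasure μ] {φ : Ω → ℝ} (hφ : Measurable φ) (hint : Integrable φ μ) :
    ∀ᵐ ω ∂(Measure.infinitePi fun _ : ℕ => μ),
      Tendsto (fun N : ℕ => (∑ n ∈ Finset.range N, φ (ω n)) / N) atTop (𝓝 (∫ ω, φ ω ∂μ)) := by
  have hmp : ∀ n, MeasurePreserving (fun ω : ℕ → Ω => ω n) (Measure.infinitePi fun _ : ℕ => μ) μ :=
    fun n => measurePreserving_eval_infinitePi (fun _ : ℕ => μ) n
  have hind : iIndepFun (fun (n : ℕ) (ω : ℕ → Ω) => φ (ω n)) (Measure.infinitePi fun _ => μ) :=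
    iIndepFun_infinitePi fun _ => hφ
  have h := strong_law_ae_real (μ := Measure.infinitePi fun _ : ℕ => μ)
    (fun n ω => φ (ω n)) ((hmp 0).integrable_comp_of_integrable hint)
    (fun i j hij => hind.indepFun hij)
    (fun n => ⟨(hφ.comp (measurable_pi_apply n)).aemeasurable,
      (hφ.comp (measurable_pi_apply 0)).aemeasurable, by
        have h1 := Measure.map_map (μ := Measure.infinitePi fun _ : ℕ => μ) hφ (hmp n).measurable
        have h2 := Measure.map_map (μ := Measure.infinitePi fun _ : ℕ => μ) hφ (hmp 0).measurable
        rw [(hmp n).map_eq] at h1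
        rw [(hmp 0).map_eq] at h2
        exact h1.symm.trans h2⟩)
  have h0 : ∫ ω : ℕ → Ω, φ (ω 0) ∂(Measure.infinitePi fun _ : ℕ => μ) = ∫ ω, φ ω ∂μ := by
    have := integral_map (μ := Measure.infinitePi fun _ : ℕ => μ)
      (hmp 0).measurable.aemeasurable hφ.aestronglyMeasurable
    rw [(hmp 0).map_eq] at this
    exact this.symm
  rw [h0] at h
  exact h

/-- If the averages of nonnegative i.i.d. random variables converge, they are integrable. -/
lemma integrable_of_tendsto_average_infinitePi {Ω : Type*} [MeasurableSpace Ω] (μ : Measure Ω)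
    [IsProbabilityMeasure μ] {φ : Ω → ℝ} (hφ : Measurable φ) (h0 : ∀ ω, 0 ≤ φ ω) {c : ℝ}
    (hc : ∀ᵐ ω ∂(Measure.infinitePi fun _ : ℕ => μ),
      Tendsto (fun N : ℕ => (∑ n ∈ Finset.range N, φ (ω n)) / N) atTop (𝓝 c)) :
    Integrable φ μ := by
  -- Truncation at `K`: the strong law applies to the bounded variable, whose mean is therefore at
  -- most `c`; monotone convergence in `K` transfers the bound to `φ`.
  have hm : ∀ K : ℕ, Measurable fun ω => min (φ ω) K := fun K => hφ.min measurable_const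
  have hi : ∀ K : ℕ, Integrable (fun ω => min (φ ω) K) μ := fun K =>
    Integrable.of_bound (hm K).aestronglyMeasurable (K : ℝ) (ae_of_all _ fun ω => by
      rw [Real.norm_of_nonneg (le_min (h0 ω) K.cast_nonneg)]
      exact min_le_right _ _)
  have hle : ∀ K : ℕ, ∫ ω, min (φ ω) K ∂μ ≤ c := by
    intro K
    obtain ⟨ω, hω, hω'⟩ := ((tendsto_average_infinitePi μ (hm K) (hi K)).and hc).exists
    exact le_of_tendsto_of_tendsto' hω hω' fun N => by
      gcongr
      exact min_le_left _ _
  have hlim : ∀ ω, Tendsto (fun K : ℕ => ENNReal.ofReal (min (φ ω) K)) atTop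
      (𝓝 (ENNReal.ofReal (φ ω))) := by
    intro ω
    obtain ⟨K₀, hK₀⟩ := exists_nat_ge (φ ω)
    refine tendsto_const_nhds.congr' ?_
    filter_upwards [eventually_ge_atTop K₀] with K hK
    rw [min_eq_left (hK₀.trans (by exact_mod_cast hK))]
  have hmc : Tendsto (fun K : ℕ => ∫⁻ ω, ENNReal.ofReal (min (φ ω) K) ∂μ) atTop
      (𝓝 (∫⁻ ω, ENNReal.ofReal (φ ω) ∂μ)) :=
    lintegral_tendsto_of_tendsto_of_monotone (fun K => (hm K).ennreal_ofReal.aemeasurable)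
      (ae_of_all _ fun ω K K' h => by
        dsimp only
        gcongr) (ae_of_all _ hlim)
  have hbd : ∫⁻ ω, ENNReal.ofReal (φ ω) ∂μ ≤ ENNReal.ofReal c := by
    refine le_of_tendsto' hmc fun K => ?_
    rw [← ofReal_integral_eq_lintegral_ofReal (hi K)
      (ae_of_all _ fun ω => le_min (h0 ω) K.cast_nonneg)]
    exact ENNReal.ofReal_le_ofReal (hle K)
  refine ⟨hφ.aestronglyMeasurable, ?_⟩
  rw [hasFiniteIntegral_iff_ofReal (ae_of_all _ h0)]
  exact hbd.trans_lt ENNReal.ofReal_lt_top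

/-- The normalized log-MGF is an average of i.i.d. terms `symbolLogMGF`. These are nonpositive, so
almost sure convergence to a finite limit already forces integrability, and the limit is the mean.
-/
lemma isLimitLogMGF_iff {Ω : Type*} [MeasurableSpace Ω] (μ : Measure Ω) [IsProbabilityMeasure μ]
    {p θ : ℝ} (hp : 0 < p) (hθ : θ < 0) {G F : Ω → ℂ} (hG : Measurable G) (hF : Measurable F)
    (Λ : ℝ) :
    IsLimitLogMGF μ p G F θ Λ ↔ Integrable (fun ω => symbolLogMGF p θ (G ω) (F ω)) μ ∧
      ∫ ω, symbolLogMGF p θ (G ω) (F ω) ∂μ = Λ := by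
  set φ : Ω → ℝ := fun ω => symbolLogMGF p θ (G ω) (F ω) with hφdef
  have hφ : Measurable φ := measurable_symbolLogMGF p θ hG hF
  have key : ∀ ω : ℕ → Ω, (fun N : ℕ => (1 / (N : ℝ)) *
      logMGF p (fun n : Fin N => G (ω n)) (fun n : Fin N => F (ω n)) (N * θ)) =ᶠ[atTop]
      fun N : ℕ => (∑ n ∈ Finset.range N, φ (ω n)) / N := by
    intro ω
    filter_upwards [eventually_ne_atTop 0] with N hN
    rw [logMGF_eq_sum hp hθ hN, Finset.sum_range, one_div, inv_mul_eq_div]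
  have hiff : IsLimitLogMGF μ p G F θ Λ ↔ ∀ᵐ ω ∂(Measure.infinitePi fun _ : ℕ => μ),
      Tendsto (fun N : ℕ => (∑ n ∈ Finset.range N, φ (ω n)) / N) atTop (𝓝 Λ) :=
    eventually_congr (ae_of_all _ fun ω => tendsto_congr' (key ω))
  rw [hiff]
  constructor
  · intro h
    have hint : Integrable φ μ := by
      have := integrable_of_tendsto_average_infinitePi μ hφ.neg
        (fun ω => neg_nonneg.2 (symbolLogMGF_nonpos hp hθ (G ω) (F ω))) (c := -Λ) (by
          filter_upwards [h] with ω hω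
          simpa [Finset.sum_neg_distrib, neg_div] using hω.neg)
      simpa using this.neg
    refine ⟨hint, ?_⟩
    obtain ⟨ω, hω, hω'⟩ := ((tendsto_average_infinitePi μ hφ hint).and h).exists
    exact tendsto_nhds_unique hω hω'
  · rintro ⟨hint, rfl⟩
    exact tendsto_average_infinitePi μ hφ hint

/-! ### Rank-one perturbations of multiples of the identity -/

section Matrices

open scoped ComplexOrder

variable {ι n : Type*} [Fintype n] [DecidableEq n]

/-- The matrix `∑_{k ∈ s} a_k v_k v_k^* + b I`. -/
def interference (a : ι → ℝ) (b : ℝ) (s : Finset ι) (v : ι → n → ℂ) : Matrix n n ℂ :=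
  ∑ k ∈ s, (a k : ℂ) • Matrix.vecMulVec (v k) (star (v k)) + (b : ℂ) • 1

lemma posDef_interference {a : ι → ℝ} {b : ℝ} (ha : ∀ k, 0 ≤ a k) (hb : 0 < b) (s : Finset ι)
    (v : ι → n → ℂ) : (interference a b s v).PosDef := by
  refine Matrix.PosDef.posSemidef_add (Matrix.posSemidef_sum s fun k _ => ?_) ?_
  · exact (Matrix.posSemidef_vecMulVec_self_star (v k)).smul (by exact_mod_cast ha k)
  · exact Matrix.PosDef.one.smul (by exact_mod_cast hb)

lemma isUnit_det_interference {a : ι → ℝ} {b : ℝ} (ha : ∀ k, 0 ≤ a k) (hb : 0 < b) (s : Finset ι)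
    (v : ι → n → ℂ) : IsUnit (interference a b s v).det :=
  (Matrix.isUnit_iff_isUnit_det _).1 (posDef_interference ha hb s v).isUnit

lemma star_dotProduct_comm {n : Type*} [Fintype n] (x y : n → ℂ) : star y ⬝ᵥ x = conj (star x ⬝ᵥ y) := by
  simp [dotProduct, map_sum, mul_comm]

lemma quadratic_interference (a : ι → ℝ) (b : ℝ) (s : Finset ι) (v : ι → n → ℂ) (β : n → ℂ) :
    star β ⬝ᵥ (interference a b s v *ᵥ β) =
      ((∑ k ∈ s, a k * ‖star β ⬝ᵥ v k‖ ^ 2 + b * ∑ r, ‖β r‖ ^ 2 : ℝ) : ℂ) := by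
  have h1 : ∀ k, star β ⬝ᵥ (((a k : ℂ) • Matrix.vecMulVec (v k) (star (v k))) *ᵥ β) =
      ((a k * ‖star β ⬝ᵥ v k‖ ^ 2 : ℝ) : ℂ) := by
    intro k
    rw [Matrix.smul_mulVec, Matrix.vecMulVec_mulVec, dotProduct_smul, star_dotProduct_comm β (v k)]
    simp only [op_smul_eq_smul, dotProduct_smul, smul_eq_mul]
    push_cast
    rw [mul_comm (conj _), Complex.mul_conj, Complex.normSq_eq_norm_sq]
    push_cast
    ring
  have h2 : star β ⬝ᵥ β = ((∑ r, ‖β r‖ ^ 2 : ℝ) : ℂ) := by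
    rw [dotProduct]
    push_cast
    refine Finset.sum_congr rfl fun r _ => ?_
    rw [Pi.star_apply, RCLike.star_def, mul_comm, Complex.mul_conj, Complex.normSq_eq_norm_sq]
    push_cast
    ring
  rw [interference, Matrix.add_mulVec, Matrix.sum_mulVec, dotProduct_add, dotProduct_sum,
    Finset.sum_congr rfl fun k _ => h1 k, Matrix.smul_mulVec, Matrix.one_mulVec, dotProduct_smul, h2]
  push_cast
  rfl

/-- The Cauchy–Schwarz inequality for the pair of dual quadratic forms of `M` and `M⁻¹`. -/
lemma norm_sq_dotProduct_le {M : Matrix n n ℂ} (hM : M.PosDef) (β y : n → ℂ) :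
    ‖star β ⬝ᵥ y‖ ^ 2 ≤ (star β ⬝ᵥ (M *ᵥ β)).re * (star y ⬝ᵥ (M⁻¹ *ᵥ y)).re := by
  by_cases hy : y = 0
  · simp [hy]
  have hq : 0 < star y ⬝ᵥ (M⁻¹ *ᵥ y) := hM.inv.dotProduct_mulVec_pos hy
  obtain ⟨hq1, hq2⟩ := Complex.pos_iff.1 hq
  set q : ℝ := (star y ⬝ᵥ (M⁻¹ *ᵥ y)).re with hqdef
  have hqc : star y ⬝ᵥ (M⁻¹ *ᵥ y) = (q : ℂ) := Complex.ext rfl (by simpa using hq2.symm)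
  set u : ℂ := star β ⬝ᵥ y with hu
  set w : n → ℂ := M⁻¹ *ᵥ y with hw
  have hMw : M *ᵥ w = y := by
    rw [hw, Matrix.mulVec_mulVec, Matrix.mul_nonsing_inv _
      ((Matrix.isUnit_iff_isUnit_det _).1 hM.isUnit), Matrix.one_mulVec]
  have hwy : star w ⬝ᵥ y = q := by
    rw [star_dotProduct_comm, hqc, Complex.conj_ofReal]
  have hyβ : star y ⬝ᵥ β = conj u := by rw [hu, star_dotProduct_comm]
  have hwMβ : star w ⬝ᵥ (M *ᵥ β) = conj u := by
    have : star (M *ᵥ w) = star w ᵥ* M := by rw [Matrix.star_mulVec M w, hM.isHermitian.eq]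
    rw [Matrix.dotProduct_mulVec, ← this, hMw, hyβ]
  -- This is `q` times the component of `β` orthogonal to `w` in the inner product of `M`; the
  -- factor `q` avoids a division.
  have h := hM.posSemidef.dotProduct_mulVec_nonneg ((q : ℂ) • β - conj u • w)
  have hexp : star ((q : ℂ) • β - conj u • w) ⬝ᵥ (M *ᵥ ((q : ℂ) • β - conj u • w)) =
      (q : ℂ) ^ 2 * (star β ⬝ᵥ (M *ᵥ β)) - q * (‖u‖ ^ 2 : ℝ) := by
    have hu2 : ((‖u‖ ^ 2 : ℝ) : ℂ) = u * conj u := by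
      rw [Complex.mul_conj, Complex.normSq_eq_norm_sq]
    rw [Matrix.mulVec_sub, Matrix.mulVec_smul, Matrix.mulVec_smul, hMw, star_sub, star_smul,
      star_smul, hu2]
    simp only [sub_dotProduct, dotProduct_sub, smul_dotProduct, dotProduct_smul, smul_eq_mul,
      hwy, hwMβ, RCLike.star_def, Complex.conj_ofReal, Complex.conj_conj]
    rw [← hu]
    ring
  rw [hexp] at h
  have h2 := (Complex.nonneg_iff.1 h).1
  rw [Complex.sub_re, ← Complex.ofReal_pow, ← Complex.ofReal_mul, Complex.re_ofReal_mul,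
    Complex.ofReal_re] at h2
  have h3 : 0 ≤ q * (q * (star β ⬝ᵥ (M *ᵥ β)).re - ‖u‖ ^ 2) := by linarith
  have := nonneg_of_mul_nonneg_right h3 hq1
  linarith

/-- The quadratic form `v_i^* (∑_{k ∈ s} a_k v_k v_k^* + b I)⁻¹ v_i`. -/
def quality (a : ι → ℝ) (b : ℝ) (s : Finset ι) (v : ι → n → ℂ) (i : ι) : ℝ :=
  (star (v i) ⬝ᵥ ((interference a b s v)⁻¹ *ᵥ v i)).re

variable {a : ι → ℝ} {b : ℝ}

lemma quality_nonneg (ha : ∀ k, 0 ≤ a k) (hb : 0 < b) (s : Finset ι) (v : ι → n → ℂ) (i : ι) :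
    0 ≤ quality a b s v i :=
  (Complex.nonneg_iff.1
    ((posDef_interference ha hb s v).inv.posSemidef.dotProduct_mulVec_nonneg (v i))).1

lemma ofReal_quality (ha : ∀ k, 0 ≤ a k) (hb : 0 < b) (s : Finset ι) (v : ι → n → ℂ) (i : ι) :
    (quality a b s v i : ℂ) = star (v i) ⬝ᵥ ((interference a b s v)⁻¹ *ᵥ v i) :=
  Complex.ext rfl (Complex.nonneg_iff.1
    ((posDef_interference ha hb s v).inv.posSemidef.dotProduct_mulVec_nonneg (v i))).2

/-- After multiplication by `a i`, this bounds the signal-to-interference-plus-noise ratio at the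
output of an arbitrary filter `β`. -/
lemma norm_sq_dotProduct_le_quality (ha : ∀ k, 0 ≤ a k) (hb : 0 < b) (s : Finset ι)
    (v : ι → n → ℂ) (i : ι) (β : n → ℂ) :
    ‖star β ⬝ᵥ v i‖ ^ 2 ≤
      (∑ k ∈ s, a k * ‖star β ⬝ᵥ v k‖ ^ 2 + b * ∑ r, ‖β r‖ ^ 2) * quality a b s v i := by
  have h := norm_sq_dotProduct_le (posDef_interference ha hb s v) β (v i)
  rwa [quadratic_interference, Complex.ofReal_re] at h

/-- The vector `(∑_{k ∈ s} a_k v_k v_k^* + b I)⁻¹ v_i`, which attains equality in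
`norm_sq_dotProduct_le_quality`. -/
def mmseFilter (a : ι → ℝ) (b : ℝ) (s : Finset ι) (v : ι → n → ℂ) (i : ι) : n → ℂ :=
  (interference a b s v)⁻¹ *ᵥ v i

lemma star_mmseFilter_dotProduct (ha : ∀ k, 0 ≤ a k) (hb : 0 < b) (s : Finset ι)
    (v : ι → n → ℂ) (i : ι) : star (mmseFilter a b s v i) ⬝ᵥ v i = quality a b s v i := by
  rw [star_dotProduct_comm, mmseFilter, ← ofReal_quality ha hb, Complex.conj_ofReal]

/-- For `β = M⁻¹ v_i` one has `β^* M β = β^* v_i`, so signal amplitude and disturbance power are the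
same number. -/
lemma quadratic_mmseFilter (ha : ∀ k, 0 ≤ a k) (hb : 0 < b) (s : Finset ι)
    (v : ι → n → ℂ) (i : ι) :
    ∑ k ∈ s, a k * ‖star (mmseFilter a b s v i) ⬝ᵥ v k‖ ^ 2
      + b * ∑ r, ‖mmseFilter a b s v i r‖ ^ 2 = quality a b s v i := by
  have h := quadratic_interference a b s v (mmseFilter a b s v i)
  have hM : interference a b s v *ᵥ mmseFilter a b s v i = v i := by
    rw [mmseFilter, Matrix.mulVec_mulVec,
      Matrix.mul_nonsing_inv _ (isUnit_det_interference ha hb s v), Matrix.one_mulVec]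
  rw [hM, star_mmseFilter_dotProduct ha hb] at h
  exact_mod_cast h.symm

/-- The determinant formula for a rank-one update of an invertible matrix. -/
lemma det_interference_insert [DecidableEq ι] (ha : ∀ k, 0 ≤ a k) (hb : 0 < b) {s : Finset ι}
    {i : ι} (hi : i ∉ s) (v : ι → n → ℂ) :
    (interference a b (insert i s) v).det =
      (interference a b s v).det * ((1 + a i * quality a b s v i : ℝ) : ℂ) := by
  have h : interference a b (insert i s) v = interference a b s v +
      Matrix.replicateCol Unit ((a i : ℂ) • v i) * Matrix.replicateRow Unit (star (v i)) := by
    rw [interference, Finset.sum_insert hi, ← Matrix.vecMulVec_eq, Matrix.smul_vecMulVec,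
      interference]
    abel
  rw [h, Matrix.det_add_replicateCol_mul_replicateRow (isUnit_det_interference ha hb s v),
    Matrix.det_unique (n := Unit)]
  congr 1
  push_cast
  rw [ofReal_quality ha hb, Matrix.add_apply, Matrix.one_apply_eq, Matrix.mul_assoc,
    ← Matrix.replicateCol_mulVec, Matrix.replicateRow_mul_replicateCol_apply, Matrix.mulVec_smul,
    dotProduct_smul, smul_eq_mul]

lemma det_interference_eq (ha : ∀ k, 0 ≤ a k) (hb : 0 < b) (s : Finset ι) (v : ι → n → ℂ) :
    (interference a b s v).det = ((interference a b s v).det.re : ℂ) ∧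
      0 < (interference a b s v).det.re := by
  have h := Complex.pos_iff.1 (posDef_interference ha hb s v).det_pos
  exact ⟨Complex.ext rfl h.2.symm, h.1⟩

/-- The chain rule: successive rates add up to a log-determinant. -/
lemma sum_log_one_add_quality [LinearOrder ι] [Fintype ι] [LocallyFiniteOrderTop ι]
    (ha : ∀ k, 0 ≤ a k) (hb : 0 < b) (v : ι → n → ℂ) :
    ∑ i, Real.log (1 + a i * quality a b (Finset.Ioi i) v i) =
      Real.log ((interference a b Finset.univ v).det.re / b ^ Fintype.card n) := by
  have h : ∀ s : Finset ι, ∑ i ∈ s, Real.log (1 + a i * quality a b (s.filter (i < ·)) v i) =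
      Real.log ((interference a b s v).det.re / b ^ Fintype.card n) := by
    intro s
    -- Adding a new minimum `i` leaves the interferers of the old indices unchanged, while those of
    -- `i` are exactly `s`; hence one new determinant factor per step.
    induction s using Finset.induction_on_min with
    | empty =>
      have : (interference a b ∅ v).det.re = b ^ Fintype.card n := by
        rw [interference, Finset.sum_empty, zero_add, Matrix.det_smul, Matrix.det_one, mul_one,
          ← Complex.ofReal_pow, Complex.ofReal_re]
      rw [this, div_self (pow_pos hb _).ne', Finset.sum_empty, Real.log_one]
    | insert i s hlt ih =>
      have hi : i ∉ s := fun h => lt_irrefl _ (hlt i h)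
      have h1 : (insert i s).filter (i < ·) = s := by
        ext k
        simp only [Finset.mem_filter, Finset.mem_insert]
        constructor
        · rintro ⟨rfl | hk, h2⟩
          · exact absurd h2 (lt_irrefl _)
          · exact hk
        · exact fun hk => ⟨Or.inr hk, hlt k hk⟩
      have h2 : ∀ j ∈ s, (insert i s).filter (j < ·) = s.filter (j < ·) := by
        intro j hj
        rw [Finset.filter_insert, if_neg (not_lt.2 (hlt j hj).le)]
      rw [Finset.sum_insert hi, h1, Finset.sum_congr rfl fun j hj => by rw [h2 j hj], ih,
        det_interference_insert ha hb hi, Complex.re_mul_ofReal]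
      have hq := quality_nonneg ha hb s v i
      have hpos : 0 < 1 + a i * quality a b s v i := by
        have := mul_nonneg (ha i) hq
        linarith
      rw [mul_div_right_comm, Real.log_mul (div_pos (det_interference_eq ha hb s v).2
        (pow_pos hb _)).ne' hpos.ne', add_comm]
  have h3 := h Finset.univ
  rw [← h3]
  refine Finset.sum_congr rfl fun i _ => ?_
  congr 4
  ext k
  simp

/-- With `m = M⁻¹ v_i` and `q = m^* v_i`: `b ‖m‖² ≤ q`, since `M` dominates `b I`, and `q ≤ ‖m‖
‖v_i‖`, whence `b q² ≤ q ‖v_i‖²`. This makes the logarithms integrable. -/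
lemma quality_le (ha : ∀ k, 0 ≤ a k) (hb : 0 < b) (s : Finset ι) (v : ι → n → ℂ) (i : ι) :
    quality a b s v i ≤ b⁻¹ * ∑ r, ‖v i r‖ ^ 2 := by
  set m := mmseFilter a b s v i
  set q := quality a b s v i
  have hq0 : 0 ≤ q := quality_nonneg ha hb s v i
  have h1 : b * ∑ r, ‖m r‖ ^ 2 ≤ q := by
    have h := quadratic_mmseFilter ha hb s v i
    have : 0 ≤ ∑ k ∈ s, a k * ‖star m ⬝ᵥ v k‖ ^ 2 :=
      Finset.sum_nonneg fun k _ => mul_nonneg (ha k) (sq_nonneg _)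
    linarith
  have h2 : q ≤ ∑ r, ‖m r‖ * ‖v i r‖ := by
    have h := star_mmseFilter_dotProduct ha hb s v i
    have : ‖(q : ℂ)‖ ≤ ∑ r, ‖m r‖ * ‖v i r‖ := by
      rw [← h]
      refine (norm_sum_le _ _).trans (Finset.sum_le_sum fun r _ => ?_)
      simp [m]
    rwa [Complex.norm_real, Real.norm_of_nonneg hq0] at this
  have h3 := Finset.sum_mul_sq_le_sq_mul_sq Finset.univ (fun r => ‖m r‖) (fun r => ‖v i r‖)
  have h4 : q ^ 2 ≤ (∑ r, ‖m r‖ ^ 2) * ∑ r, ‖v i r‖ ^ 2 :=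
    (pow_le_pow_left₀ hq0 h2 2).trans h3
  have hS : 0 ≤ ∑ r, ‖v i r‖ ^ 2 := Finset.sum_nonneg fun r _ => sq_nonneg _
  rcases hq0.eq_or_lt with h0 | h0
  · rw [← h0]
    positivity
  · have h5 : b * q ≤ ∑ r, ‖v i r‖ ^ 2 := by
      have : q * (b * q) ≤ q * ∑ r, ‖v i r‖ ^ 2 := by nlinarith
      exact le_of_mul_le_mul_left this h0
    rw [inv_mul_eq_div, le_div_iff₀ hb]
    linarith

/-- By the adjugate formula the entries are continuous functions times the inverse of the
determinant, and inversion is measurable on `ℂ`, zero included. -/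
lemma measurable_interference_inv [Finite ι] (a : ι → ℝ) (b : ℝ) (s : Finset ι) (r t : n) :
    Measurable fun v : ι → n → ℂ => (interference a b s v)⁻¹ r t := by
  have hc : Continuous fun v : ι → n → ℂ => interference a b s v := by
    unfold interference
    refine continuous_matrix fun r t => ?_
    simp only [Matrix.add_apply, Matrix.sum_apply, Matrix.smul_apply, Matrix.vecMulVec_apply,
      Pi.star_apply]
    fun_prop
  simp only [Matrix.inv_def, Matrix.smul_apply, Ring.inverse_eq_inv', smul_eq_mul]
  refine Measurable.mul (Measurable.inv ?_) ?_
  · exact hc.matrix_det.measurable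
  · exact (hc.matrix_adjugate.matrix_elem r t).measurable

lemma measurable_mmseFilter [Finite ι] (a : ι → ℝ) (b : ℝ) (s : Finset ι) (i : ι) :
    Measurable fun v : ι → n → ℂ => mmseFilter a b s v i := by
  refine measurable_pi_lambda _ fun r => ?_
  simp only [mmseFilter, Matrix.mulVec, dotProduct]
  refine Finset.measurable_sum _ fun t _ => (measurable_interference_inv a b s r t).mul ?_
  fun_prop

lemma measurable_quality [Finite ι] (a : ι → ℝ) (b : ℝ) (s : Finset ι) (i : ι) :
    Measurable fun v : ι → n → ℂ => quality a b s v i := by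
  have : (fun v : ι → n → ℂ => quality a b s v i) =
      fun v => (∑ r, (star (v i) : n → ℂ) r * mmseFilter a b s v i r).re := rfl
  rw [this]
  refine Complex.measurable_re.comp (Finset.measurable_sum _ fun r _ => Measurable.mul ?_ ?_)
  · simp only [Pi.star_apply]
    fun_prop
  · exact (measurable_pi_apply r).comp (measurable_mmseFilter a b s i)

end Matrices

/-! ### Circular families -/

section Circular

variable {Ω ι : Type*} [MeasurableSpace Ω] {μ : Measure Ω}

lemma integrable_mul_conj {A B : Ω → ℂ} (hA : MemLp A 2 μ) (hB : MemLp B 2 μ) :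
    Integrable (fun ω => A ω * conj (B ω)) μ :=
  hA.integrable_mul hB.star

lemma integral_conj_eq_zero {A : Ω → ℂ} (h : ∫ ω, A ω ∂μ = 0) : ∫ ω, conj (A ω) ∂μ = 0 := by
  rw [integral_conj, h, map_zero]

lemma integral_add_add_add {f₁ f₂ f₃ f₄ : Ω → ℂ} (h₁ : Integrable f₁ μ) (h₂ : Integrable f₂ μ)
    (h₃ : Integrable f₃ μ) (h₄ : Integrable f₄ μ) :
    ∫ ω, (f₁ ω + f₂ ω + f₃ ω + f₄ ω) ∂μ =
      ∫ ω, f₁ ω ∂μ + ∫ ω, f₂ ω ∂μ + ∫ ω, f₃ ω ∂μ + ∫ ω, f₄ ω ∂μ := by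
  have h := integral_add ((h₁.add h₂).add h₃) h₄
  have h' := integral_add (h₁.add h₂) h₃
  have h'' := integral_add h₁ h₂
  simp only [Pi.add_apply] at h h' h''
  rw [h, h', h'']

/-- Centered square integrable complex random variables that are pairwise uncorrelated in the
strong sense that `E[ξ_i ξ_j] = 0` for all `i`, `j` and `E[ξ_i conj ξ_j] = 0` for `i ≠ j`. -/
structure IsCircular [DecidableEq ι] (μ : Measure Ω) (ξ : ι → Ω → ℂ) (d : ι → ℝ) : Prop where
  memLp : ∀ i, MemLp (ξ i) 2 μ
  integral_eq_zero : ∀ i, ∫ ω, ξ i ω ∂μ = 0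
  integral_mul : ∀ i j, ∫ ω, ξ i ω * ξ j ω ∂μ = 0
  integral_mul_conj : ∀ i j, ∫ ω, ξ i ω * conj (ξ j ω) ∂μ = if i = j then (d i : ℂ) else 0

variable [DecidableEq ι]

lemma isCircular_of_iIndepFun {ξ : ι → Ω → ℂ} {d : ι → ℝ} (hd : ∀ i, 0 ≤ d i)
    (hlaw : ∀ i, HasLaw (ξ i) (complexGaussian (d i)) μ) (hind : iIndepFun ξ μ) :
    IsCircular μ ξ d := by
  have hL : ∀ i, MemLp (ξ i) 2 μ := fun i =>
    (hlaw i).hasGaussianLaw.memLp_two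
  have h0 : ∀ i, ∫ ω, ξ i ω ∂μ = 0 := fun i => by
    rw [(hlaw i).integral_eq, integral_id_complexGaussian]
  refine ⟨hL, h0, fun i j => ?_, fun i j => ?_⟩
  · by_cases hij : i = j
    · subst hij
      rw [← integral_mul_self_complexGaussian (hd i)]
      exact (hlaw i).integral_comp (f := fun z => z * z) (by fun_prop)
    · rw [(hind.indepFun hij).integral_fun_mul_eq_mul_integral (hL i).1 (hL j).1, h0, zero_mul]
  · split_ifs with hij
    · subst hij
      rw [← integral_mul_conj_complexGaussian (hd i)]
      exact (hlaw i).integral_comp (f := fun z => z * conj z) (by fun_prop)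
    · have h := (hind.indepFun hij).comp (φ := fun z : ℂ => z) (ψ := fun z : ℂ => conj z)
        measurable_id Complex.continuous_conj.measurable
      have h' := h.integral_fun_mul_eq_mul_integral (hL i).1 (hL j).star.1
      refine h'.trans ?_
      change (∫ ω, ξ i ω ∂μ) * _ = 0
      rw [h0, zero_mul]

/-- Means and the moments `E[ξ_i ξ_j]` vanish for any combination, so only the Hermitian covariances
have to be checked in `hd'`. Each new variable mixes `ξ i` with one partner `ξ (s i)`, as fading and
pilot noise are mixed below. -/
lemma IsCircular.linear_comb [IsProbabilityMeasure μ] {ξ : ι → Ω → ℂ} {d : ι → ℝ}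
    (h : IsCircular μ ξ d) (α β : ι → ℂ) (s : ι → ι) (d' : ι → ℝ)
    (hd' : ∀ i j, α i * conj (α j) * (if i = j then (d i : ℂ) else 0)
      + α i * conj (β j) * (if i = s j then (d i : ℂ) else 0)
      + β i * conj (α j) * (if s i = j then (d (s i) : ℂ) else 0)
      + β i * conj (β j) * (if s i = s j then (d (s i) : ℂ) else 0) =
        if i = j then (d' i : ℂ) else 0) :
    IsCircular μ (fun i ω => α i * ξ i ω + β i * ξ (s i) ω) d' := by
  have hI : ∀ i, Integrable (ξ i) μ := fun i => (h.memLp i).integrable (by norm_num)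
  have hm : ∀ i j, Integrable (fun ω => ξ i ω * ξ j ω) μ := fun i j =>
    (h.memLp i).integrable_mul (h.memLp j)
  have hc : ∀ i j, Integrable (fun ω => ξ i ω * conj (ξ j ω)) μ := fun i j =>
    SGNNDR.integrable_mul_conj (h.memLp i) (h.memLp j)
  refine ⟨fun i => ((h.memLp i).const_mul _).add ((h.memLp _).const_mul _), fun i => ?_,
    fun i j => ?_, fun i j => ?_⟩
  · rw [integral_add ((hI i).const_mul _) ((hI _).const_mul _), integral_const_mul,
      integral_const_mul, h.integral_eq_zero, h.integral_eq_zero]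
    simp
  · have e : (fun ω => (α i * ξ i ω + β i * ξ (s i) ω) * (α j * ξ j ω + β j * ξ (s j) ω)) =
        fun ω => α i * α j * (ξ i ω * ξ j ω) + α i * β j * (ξ i ω * ξ (s j) ω)
          + β i * α j * (ξ (s i) ω * ξ j ω) + β i * β j * (ξ (s i) ω * ξ (s j) ω) := by
      ext ω; ring
    rw [e, integral_add_add_add ((hm _ _).const_mul _) ((hm _ _).const_mul _)
      ((hm _ _).const_mul _) ((hm _ _).const_mul _)]
    simp only [integral_const_mul, h.integral_mul, mul_zero, add_zero]
  · have e : (fun ω => (α i * ξ i ω + β i * ξ (s i) ω) *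
          conj (α j * ξ j ω + β j * ξ (s j) ω)) =
        fun ω => α i * conj (α j) * (ξ i ω * conj (ξ j ω))
          + α i * conj (β j) * (ξ i ω * conj (ξ (s j) ω))
          + β i * conj (α j) * (ξ (s i) ω * conj (ξ j ω))
          + β i * conj (β j) * (ξ (s i) ω * conj (ξ (s j) ω)) := by
      ext ω; simp only [map_add, map_mul]; ring
    rw [e, integral_add_add_add ((hc _ _).const_mul _) ((hc _ _).const_mul _)
      ((hc _ _).const_mul _) ((hc _ _).const_mul _)]
    simp only [integral_const_mul, h.integral_mul_conj]
    exact hd' i j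

/-- Jointly Gaussian circular families are independent. -/
lemma IsCircular.iIndepFun [Fintype ι] {ξ : ι → Ω → ℂ} {d : ι → ℝ} (h : IsCircular μ ξ d)
    (hξ : HasGaussianLaw (fun ω i => ξ i ω) μ) : iIndepFun ξ μ := by
  have := hξ.isProbabilityMeasure
  refine hξ.iIndepFun_of_covariance_inner fun i j hij x y => ?_
  simp only [Complex.inner]
  have hI : ∀ i (x : ℂ), MemLp (fun ω => ξ i ω * conj x) 2 μ := fun i x =>
    (h.memLp i).mul_const _
  have h0 : ∀ i (x : ℂ), ∫ ω, (ξ i ω * conj x).re ∂μ = 0 := fun i x => by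
    have h1 := integral_re (𝕜 := ℂ) ((hI i x).integrable (by norm_num))
    refine h1.trans ?_
    rw [integral_mul_const, h.integral_eq_zero, zero_mul, map_zero]
  have hm : Integrable (fun ω => (ξ i ω * conj x) * (ξ j ω * conj y)) μ :=
    (hI i x).integrable_mul (hI j y)
  have hc : Integrable (fun ω => (ξ i ω * conj x) * conj (ξ j ω * conj y)) μ :=
    SGNNDR.integrable_mul_conj (hI i x) (hI j y)
  have h1 : ∫ ω, (ξ i ω * conj x) * (ξ j ω * conj y) ∂μ = 0 := by
    have : (fun ω => (ξ i ω * conj x) * (ξ j ω * conj y)) =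
        fun ω => conj x * conj y * (ξ i ω * ξ j ω) := by
      ext ω; ring
    rw [this, integral_const_mul, h.integral_mul, mul_zero]
  have h2 : ∫ ω, (ξ i ω * conj x) * conj (ξ j ω * conj y) ∂μ = 0 := by
    have : (fun ω => (ξ i ω * conj x) * conj (ξ j ω * conj y)) =
        fun ω => conj x * y * (ξ i ω * conj (ξ j ω)) := by
      ext ω; simp only [map_mul, Complex.conj_conj]; ring
    rw [this, integral_const_mul, h.integral_mul_conj, if_neg hij, mul_zero]
  -- Uses `Re z Re w = Re (z w + z conj w) / 2`, so that both kinds of vanishing moments are needed.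
  have h3 : ∫ ω, (ξ i ω * conj x).re * (ξ j ω * conj y).re ∂μ = 0 := by
    have e : (fun ω => (ξ i ω * conj x).re * (ξ j ω * conj y).re) =
        fun ω => 2⁻¹ * RCLike.re ((ξ i ω * conj x) * (ξ j ω * conj y)
          + (ξ i ω * conj x) * conj (ξ j ω * conj y)) := by
      ext ω
      simp only [RCLike.re_to_complex, Complex.add_re, Complex.mul_re, Complex.conj_re,
        Complex.conj_im]
      ring
    have h4 := integral_re (𝕜 := ℂ) (hm.add hc)
    have h5 := integral_add hm hc
    rw [h1, h2, add_zero] at h5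
    rw [e, integral_const_mul]
    refine mul_eq_zero_of_right _ (h4.trans ?_)
    simp only [Pi.add_apply]
    rw [h5, map_zero]
  refine (covariance_eq_sub (hI i x).re (hI j y).re).trans ?_
  change ∫ ω, (ξ i ω * conj x).re * (ξ j ω * conj y).re ∂μ -
    (∫ ω, (ξ i ω * conj x).re ∂μ) * (∫ ω, (ξ j ω * conj y).re ∂μ) = 0
  rw [h0 i x, h3, zero_mul, sub_zero]

end Circular

/-- Tuples of independent variables with disjoint index sets are independent. -/
lemma indepFun_of_disjoint_range {Ω ι κ₁ κ₂ E : Type*} [MeasurableSpace Ω] [MeasurableSpace E]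
    {μ : Measure Ω} [Fintype κ₁] [Fintype κ₂] {ξ : ι → Ω → E} (hind : iIndepFun ξ μ)
    (hm : ∀ i, Measurable (ξ i)) (e₁ : κ₁ → ι) (e₂ : κ₂ → ι) (hne : ∀ a b, e₁ a ≠ e₂ b) :
    IndepFun (fun ω a => ξ (e₁ a) ω) (fun ω b => ξ (e₂ b) ω) μ := by
  classical
  have h := hind.indepFun_finset (Finset.univ.image e₁) (Finset.univ.image e₂) (by
    rw [Finset.disjoint_left]
    intro i hi hi'
    obtain ⟨a, -, rfl⟩ := Finset.mem_image.1 hi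
    obtain ⟨b, -, hb⟩ := Finset.mem_image.1 hi'
    exact hne a b hb.symm) hm
  exact h.comp (φ := fun x a => x ⟨e₁ a, Finset.mem_image_of_mem _ (Finset.mem_univ a)⟩)
    (ψ := fun x b => x ⟨e₂ b, Finset.mem_image_of_mem _ (Finset.mem_univ b)⟩)
    (by fun_prop) (by fun_prop)

/-! ### Second moments of random linear combinations -/

section SecondMoment

variable {Ω J 𝓥 : Type*} [MeasurableSpace Ω] {μ : Measure Ω} [Fintype J] [DecidableEq J]
  {W : J → Ω → ℂ} {d : J → ℝ}

lemma integral_norm_sq_sum (hL : ∀ j, MemLp (W j) 2 μ)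
    (hW : ∀ j l, ∫ ω, W j ω * conj (W l ω) ∂μ = if j = l then (d j : ℂ) else 0) (w : J → ℂ) :
    ∫ ω, ‖∑ j, w j * W j ω‖ ^ 2 ∂μ = ∑ j, d j * ‖w j‖ ^ 2 := by
  have hc : ∀ j l, Integrable (fun ω => W j ω * conj (W l ω)) μ := fun j l =>
    integrable_mul_conj (hL j) (hL l)
  have h1 : ∀ ω, ((‖∑ j, w j * W j ω‖ ^ 2 : ℝ) : ℂ) =
      ∑ j, ∑ l, w j * conj (w l) * (W j ω * conj (W l ω)) := by
    intro ω
    rw [← Complex.normSq_eq_norm_sq, ← Complex.mul_conj, map_sum, Finset.sum_mul_sum]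
    refine Finset.sum_congr rfl fun j _ => Finset.sum_congr rfl fun l _ => ?_
    rw [map_mul]
    ring
  have h2 : ((∫ ω, ‖∑ j, w j * W j ω‖ ^ 2 ∂μ : ℝ) : ℂ) = ((∑ j, d j * ‖w j‖ ^ 2 : ℝ) : ℂ) := by
    rw [← integral_complex_ofReal]
    simp_rw [h1]
    rw [integral_finsetSum _ fun j _ => integrable_finsetSum _ fun l _ => (hc j l).const_mul _]
    push_cast
    refine Finset.sum_congr rfl fun j _ => ?_
    rw [integral_finsetSum _ fun l _ => (hc j l).const_mul _]
    simp only [integral_const_mul, hW, mul_ite, mul_zero, Finset.sum_ite_eq, Finset.mem_univ,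
      if_true]
    rw [Complex.mul_conj, Complex.normSq_eq_norm_sq]
    push_cast
    ring
  exact_mod_cast h2

variable [MeasurableSpace 𝓥] {V : Ω → 𝓥} {c : 𝓥 → ℝ} {w : 𝓥 → J → ℂ}

/-- Tonelli for the independent pair `(V, W)`, with the second moments computed for frozen `V`.
Lower integrals are used because the receiver coefficients carry no integrability. The weight `c`
accommodates the CSI-dependent denominator of `symbolLogMGF`. -/
lemma lintegral_norm_sq_sum [IsProbabilityMeasure μ] (hL : ∀ j, MemLp (W j) 2 μ)
    (hW : ∀ j l, ∫ ω, W j ω * conj (W l ω) ∂μ = if j = l then (d j : ℂ) else 0)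
    (hWm : ∀ j, Measurable (W j)) (hV : Measurable V)
    (hind : IndepFun V (fun ω j => W j ω) μ) (hc : Measurable c) (hc0 : ∀ v, 0 ≤ c v)
    (hw : Measurable w) :
    ∫⁻ ω, ENNReal.ofReal (c (V ω) * ‖∑ j, w (V ω) j * W j ω‖ ^ 2) ∂μ =
      ∫⁻ ω, ENNReal.ofReal (c (V ω) * ∑ j, d j * ‖w (V ω) j‖ ^ 2) ∂μ := by
  have hWm' : Measurable fun ω j => W j ω := measurable_pi_lambda _ hWm
  have hwj : ∀ j, Measurable fun v => w v j := fun j => (measurable_pi_apply j).comp hw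
  have hφ : Measurable fun q : 𝓥 × (J → ℂ) =>
      ENNReal.ofReal (c q.1 * ‖∑ j, w q.1 j * q.2 j‖ ^ 2) := by
    refine ((hc.comp measurable_fst).mul (Measurable.pow_const (Measurable.norm
      (Finset.measurable_sum _ fun j _ => ((hwj j).comp measurable_fst).mul ?_)) 2)).ennreal_ofReal
    exact (measurable_pi_apply j).comp measurable_snd
  have hψ : Measurable fun v => ENNReal.ofReal (c v * ∑ j, d j * ‖w v j‖ ^ 2) :=
    (hc.mul (Finset.measurable_sum _ fun j _ =>
      ((hwj j).norm.pow_const 2).const_mul _)).ennreal_ofReal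
  have hinner : ∀ v, ∫⁻ x, ENNReal.ofReal (c v * ‖∑ j, w v j * x j‖ ^ 2)
      ∂(μ.map fun ω j => W j ω) = ENNReal.ofReal (c v * ∑ j, d j * ‖w v j‖ ^ 2) := by
    intro v
    have hm : Measurable fun x : J → ℂ => ENNReal.ofReal (c v * ‖∑ j, w v j * x j‖ ^ 2) :=
      hφ.comp measurable_prodMk_left
    have hL2 : MemLp (fun ω => ∑ j, w v j * W j ω) 2 μ :=
      memLp_finsetSum _ fun j _ => (hL j).const_mul _
    have hint : Integrable (fun ω => c v * ‖∑ j, w v j * W j ω‖ ^ 2) μ :=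
      hL2.norm.integrable_sq.const_mul _
    rw [lintegral_map hm hWm', ← integral_norm_sq_sum hL hW, ← integral_const_mul,
      ofReal_integral_eq_lintegral_ofReal hint
        (ae_of_all _ fun ω => mul_nonneg (hc0 v) (sq_nonneg _))]
  calc ∫⁻ ω, ENNReal.ofReal (c (V ω) * ‖∑ j, w (V ω) j * W j ω‖ ^ 2) ∂μ
      = ∫⁻ q : 𝓥 × (J → ℂ), ENNReal.ofReal (c q.1 * ‖∑ j, w q.1 j * q.2 j‖ ^ 2)
          ∂(μ.map fun ω => (V ω, fun j => W j ω)) := (lintegral_map hφ (hV.prodMk hWm')).symm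
    _ = ∫⁻ v, ∫⁻ x, ENNReal.ofReal (c v * ‖∑ j, w v j * x j‖ ^ 2)
          ∂(μ.map fun ω j => W j ω) ∂(μ.map V) := by
        rw [(indepFun_iff_map_prod_eq_prod_map_map hV.aemeasurable hWm'.aemeasurable).1 hind]
        exact lintegral_prod _ hφ.aemeasurable
    _ = ∫⁻ v, ENNReal.ofReal (c v * ∑ j, d j * ‖w v j‖ ^ 2) ∂(μ.map V) :=
        lintegral_congr hinner
    _ = _ := lintegral_map hψ hV

lemma integrable_and_integral_eq_of_lintegral_eq {f g : Ω → ℝ} (hf : Measurable f)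
    (hg : Measurable g) (hf0 : ∀ ω, 0 ≤ f ω) (hg0 : ∀ ω, 0 ≤ g ω)
    (h : ∫⁻ ω, ENNReal.ofReal (f ω) ∂μ = ∫⁻ ω, ENNReal.ofReal (g ω) ∂μ) :
    (Integrable f μ ↔ Integrable g μ) ∧ ∫ ω, f ω ∂μ = ∫ ω, g ω ∂μ := by
  constructor
  · refine ⟨fun hi => ⟨hg.aestronglyMeasurable, ?_⟩, fun hi => ⟨hf.aestronglyMeasurable, ?_⟩⟩
    · rw [hasFiniteIntegral_iff_ofReal (ae_of_all _ hg0), ← h]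
      exact (hasFiniteIntegral_iff_ofReal (ae_of_all _ hf0)).1 hi.2
    · rw [hasFiniteIntegral_iff_ofReal (ae_of_all _ hf0), h]
      exact (hasFiniteIntegral_iff_ofReal (ae_of_all _ hg0)).1 hi.2
  · rw [integral_eq_lintegral_of_nonneg_ae (ae_of_all _ hf0) hf.aestronglyMeasurable,
      integral_eq_lintegral_of_nonneg_ae (ae_of_all _ hg0) hg.aestronglyMeasurable, h]

end SecondMoment

/-! ### Estimation of the channel from the received pilot -/

/-- The index set of the scalar sources of randomness of one channel use. -/
abbrev Source (nt nr : ℕ) := (Fin nt × Fin nr) ⊕ (Fin nt × Fin nr) ⊕ Fin nt ⊕ Fin nr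

/-- The involution of `Source` that exchanges fading and pilot noise. -/
def Source.swap {nt nr : ℕ} : Source nt nr → Source nt nr
  | .inl p => .inr (.inl p)
  | .inr (.inl p) => .inl p
  | .inr (.inr q) => .inr (.inr q)

namespace PilotChannel

variable {Ω : Type*} [MeasurableSpace Ω] {μ : Measure Ω} {nt nr : ℕ}

/-- The sources of randomness of a pilot channel. -/
def source (C : PilotChannel μ nt nr) : Source nt nr → Ω → ℂ := primitives C.h C.Zp C.X C.Z

/-- Variances of the sources of randomness. -/
def sourceVar (C : PilotChannel μ nt nr) : Source nt nr → ℝ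
  | .inl p => C.η p.1 ^ 2
  | .inr (.inl _) => C.σ ^ 2
  | .inr (.inr (.inl i)) => C.P i
  | .inr (.inr (.inr _)) => C.σ ^ 2

/-- Variance of the entries of the received pilot. -/
def pilotVar (C : PilotChannel μ nt nr) (i : Fin nt) : ℝ := C.η i ^ 2 * ‖C.xp‖ ^ 2 + C.σ ^ 2

/-- The coefficient of the linear MMSE estimate of `h_i` from `Y_{p,i}`. -/
def mmseCoeff (C : PilotChannel μ nt nr) (i : Fin nt) : ℂ :=
  C.η i ^ 2 * conj C.xp / (C.pilotVar i : ℂ)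

/-- Variance of the entries of the estimation error of `h_i`. -/
def errVar (C : PilotChannel μ nt nr) (i : Fin nt) : ℝ := C.η i ^ 2 * C.σ ^ 2 / C.pilotVar i

/-- The error of the linear MMSE estimate of `h_i`. -/
def err (C : PilotChannel μ nt nr) (ω : Ω) (i : Fin nt) (r : Fin nr) : ℂ :=
  C.h ω i r - C.mmseCoeff i * C.Yp ω i r

/-- The sources of randomness after the change of variables `(h, Z_p) ↦ (err, Y_p)`. -/
def decorrelated (C : PilotChannel μ nt nr) : Source nt nr → Ω → ℂ
  | .inl p => fun ω => C.err ω p.1 p.2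
  | .inr (.inl p) => fun ω => C.Yp ω p.1 p.2
  | .inr (.inr (.inl i)) => fun ω => C.X ω i
  | .inr (.inr (.inr r)) => fun ω => C.Z ω r

/-- Variances of the decorrelated sources. -/
def decorrelatedVar (C : PilotChannel μ nt nr) : Source nt nr → ℝ
  | .inl p => C.errVar p.1
  | .inr (.inl p) => C.pilotVar p.1
  | .inr (.inr (.inl i)) => C.P i
  | .inr (.inr (.inr _)) => C.σ ^ 2

/-- Coefficient of `source i` in `decorrelated i`. -/
def coeffSelf (C : PilotChannel μ nt nr) : Source nt nr → ℂ
  | .inl p => 1 - C.mmseCoeff p.1 * C.xp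
  | .inr _ => 1

/-- Coefficient of `source i.swap` in `decorrelated i`. -/
def coeffSwap (C : PilotChannel μ nt nr) : Source nt nr → ℂ
  | .inl p => -C.mmseCoeff p.1
  | .inr (.inl _) => C.xp
  | .inr (.inr _) => 0

variable (C : PilotChannel μ nt nr)

lemma decorrelated_eq (i : Source nt nr) :
    C.decorrelated i =
      fun ω => C.coeffSelf i * C.source i ω + C.coeffSwap i * C.source i.swap ω := by
  ext ω
  rcases i with p | p | i | r
  · simp only [decorrelated, err, Yp, coeffSelf, coeffSwap, source, primitives, Source.swap,
      Pi.add_apply, Pi.smul_apply, smul_eq_mul]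
    ring
  · simp only [decorrelated, Yp, coeffSelf, coeffSwap, source, primitives, Source.swap,
      Pi.add_apply, Pi.smul_apply, smul_eq_mul]
    ring
  · simp [decorrelated, coeffSelf, coeffSwap, source, primitives]
  · simp [decorrelated, coeffSelf, coeffSwap, source, primitives]

lemma pilotVar_pos (i : Fin nt) : 0 < C.pilotVar i := by
  have := C.σ_pos
  unfold pilotVar
  positivity

lemma sourceVar_nonneg (i : Source nt nr) : 0 ≤ C.sourceVar i := by
  rcases i with p | p | i | r
  · exact sq_nonneg _
  · exact sq_nonneg _
  · exact (C.P_pos i).le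
  · exact sq_nonneg _

lemma hasLaw_source (i : Source nt nr) : HasLaw (C.source i) (complexGaussian (C.sourceVar i)) μ := by
  rcases i with p | p | i | r
  · exact C.law_h p.1 p.2
  · exact C.law_Zp p.1 p.2
  · exact C.law_X i
  · exact C.law_Z r

lemma isCircular_source : IsCircular μ C.source C.sourceVar :=
  isCircular_of_iIndepFun C.sourceVar_nonneg C.hasLaw_source C.indep

lemma ofReal_pilotVar_ne_zero (i : Fin nt) : (C.pilotVar i : ℂ) ≠ 0 := by
  exact_mod_cast (C.pilotVar_pos i).ne'

lemma ofReal_pilotVar (i : Fin nt) :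
    (C.pilotVar i : ℂ) = C.η i ^ 2 * (C.xp * conj C.xp) + C.σ ^ 2 := by
  rw [Complex.mul_conj, Complex.normSq_eq_norm_sq, pilotVar]
  push_cast
  ring

/-- The orthogonality principle: `mmseCoeff` is `E[h conj Y_p] / E|Y_p|²`, which makes the error
uncorrelated with the pilot. -/
lemma isCircular_decorrelated [IsProbabilityMeasure μ] :
    IsCircular μ C.decorrelated C.decorrelatedVar := by
  have h := C.isCircular_source.linear_comb C.coeffSelf C.coeffSwap Source.swap C.decorrelatedVar ?_
  · rwa [← funext C.decorrelated_eq] at h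
  intro i j
  rcases i with p | p | i | r <;> rcases j with q | q | j | s <;>
    simp only [coeffSelf, coeffSwap, Source.swap, sourceVar, decorrelatedVar, Sum.inl.injEq,
      Sum.inr.injEq, reduceCtorEq, if_false, mul_zero, zero_mul, add_zero, zero_add, map_one,
      mul_one, one_mul, map_zero]
  -- The four remaining pairs are error–error, error–pilot, pilot–error and pilot–pilot; each
  -- reduces to the definition of `pilotVar`.
  · split_ifs with hpq
    · subst hpq
      have h0 := C.ofReal_pilotVar_ne_zero p.1
      have hv := C.ofReal_pilotVar p.1
      simp only [mmseCoeff, errVar, map_sub, map_one, map_mul, map_div₀, map_pow, map_neg,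
        Complex.conj_ofReal, Complex.conj_conj]
      push_cast
      field_simp
      rw [hv]
      ring
    · simp
  · split_ifs with hpq
    · subst hpq
      have h0 := C.ofReal_pilotVar_ne_zero p.1
      have hv := C.ofReal_pilotVar p.1
      simp only [mmseCoeff]
      push_cast
      field_simp
      rw [hv]
      ring
    · simp
  · split_ifs with hpq
    · subst hpq
      have h0 := C.ofReal_pilotVar_ne_zero p.1
      have hv := C.ofReal_pilotVar p.1
      simp only [mmseCoeff, map_sub, map_one, map_mul, map_div₀, map_pow, map_neg,
        Complex.conj_ofReal, Complex.conj_conj]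
      push_cast
      field_simp
      rw [hv]
      ring
    · simp
  · split_ifs with hpq
    · subst hpq
      rw [C.ofReal_pilotVar]
      push_cast
      ring
    · simp

lemma hasGaussianLaw_decorrelated : HasGaussianLaw (fun ω i => C.decorrelated i ω) μ := by
  have h : HasGaussianLaw (fun ω i => C.source i ω) μ :=
    C.indep.hasGaussianLaw fun i => (C.hasLaw_source i).hasGaussianLaw
  have h' := h.map_fun (ContinuousLinearMap.pi fun i =>
    C.coeffSelf i • ContinuousLinearMap.proj (R := ℝ) (φ := fun _ : Source nt nr => ℂ) i
      + C.coeffSwap i • ContinuousLinearMap.proj (R := ℝ) (φ := fun _ : Source nt nr => ℂ) i.swap)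
  refine h'.congr (ae_of_all _ fun ω => ?_)
  ext i
  simp [decorrelated_eq]

lemma iIndepFun_decorrelated [IsProbabilityMeasure μ] : iIndepFun C.decorrelated μ :=
  C.isCircular_decorrelated.iIndepFun C.hasGaussianLaw_decorrelated

@[fun_prop]
lemma measurable_h_apply (i : Fin nt) (r : Fin nr) : Measurable fun ω => C.h ω i r :=
  (measurable_pi_apply r).comp ((measurable_pi_apply i).comp C.measurable_h)

@[fun_prop]
lemma measurable_X_apply (i : Fin nt) : Measurable fun ω => C.X ω i :=
  (measurable_pi_apply i).comp C.measurable_X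

@[fun_prop]
lemma measurable_Z_apply (r : Fin nr) : Measurable fun ω => C.Z ω r :=
  (measurable_pi_apply r).comp C.measurable_Z

@[fun_prop]
lemma measurable_Yp_apply (i : Fin nt) (r : Fin nr) : Measurable fun ω => C.Yp ω i r := by
  have h : Measurable fun ω => C.Zp ω i r :=
    (measurable_pi_apply r).comp ((measurable_pi_apply i).comp C.measurable_Zp)
  exact ((C.measurable_h_apply i r).const_mul C.xp).add h

@[fun_prop]
lemma measurable_Yp : Measurable C.Yp :=
  measurable_pi_lambda _ fun i => measurable_pi_lambda _ fun r => C.measurable_Yp_apply i r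

@[fun_prop]
lemma measurable_err (i : Fin nt) (r : Fin nr) : Measurable fun ω => C.err ω i r := by
  unfold err
  fun_prop

lemma measurable_decorrelated (i : Source nt nr) : Measurable (C.decorrelated i) := by
  rcases i with p | p | i | r <;> simp only [decorrelated] <;> fun_prop

/-- The triple `(err, X, Z)`. -/
def residual (ω : Ω) : (Fin nt × Fin nr) ⊕ Fin nt ⊕ Fin nr → ℂ
  | .inl p => C.err ω p.1 p.2
  | .inr (.inl i) => C.X ω i
  | .inr (.inr r) => C.Z ω r

lemma indepFun_Yp_residual [IsProbabilityMeasure μ] : IndepFun C.Yp C.residual μ := by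
  have h := indepFun_of_disjoint_range C.iIndepFun_decorrelated C.measurable_decorrelated
    (fun p : Fin nt × Fin nr => .inr (.inl p))
    (Sum.map (id : Fin nt × Fin nr → Fin nt × Fin nr) .inr) (by rintro p (q | q) <;> simp)
  have h' := h.comp (φ := fun x (i : Fin nt) (r : Fin nr) => x (i, r)) (ψ := id)
    (by fun_prop) measurable_id
  have e : C.residual = fun ω q =>
      C.decorrelated (Sum.map (id : Fin nt × Fin nr → Fin nt × Fin nr) .inr q) ω := by
    ext ω q
    rcases q with q | q | q <;> rfl
  rw [e]
  exact h'

lemma indepFun_err_signal [IsProbabilityMeasure μ] :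
    IndepFun (fun ω (p : Fin nt × Fin nr) => C.err ω p.1 p.2)
      (fun ω (q : Fin nt ⊕ Fin nr) => C.decorrelated (.inr (.inr q)) ω) μ :=
  indepFun_of_disjoint_range C.iIndepFun_decorrelated C.measurable_decorrelated
    (fun p : Fin nt × Fin nr => .inl p) (fun q => .inr (.inr q)) (by simp)

/-- The overall noise `H̃ X + Z`, with `H̃` the error of the linear MMSE estimate. -/
def noise (ω : Ω) (r : Fin nr) : ℂ := ∑ k, C.err ω k r * C.X ω k + C.Z ω r

/-- The input and the overall noise as one family. -/
def signal : Fin nt ⊕ Fin nr → Ω → ℂ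
  | .inl k => fun ω => C.X ω k
  | .inr r => fun ω => C.noise ω r

/-- Variances of `signal`. -/
def signalVar : Fin nt ⊕ Fin nr → ℝ
  | .inl k => C.P k
  | .inr _ => C.b

@[fun_prop]
lemma measurable_noise (r : Fin nr) : Measurable fun ω => C.noise ω r := by
  unfold noise
  fun_prop

lemma measurable_signal (j : Fin nt ⊕ Fin nr) : Measurable (C.signal j) := by
  rcases j with k | r <;> simp only [signal] <;> fun_prop

lemma memLp_err [IsProbabilityMeasure μ] (k : Fin nt) (r : Fin nr) :
    MemLp (fun ω => C.err ω k r) 2 μ := C.isCircular_decorrelated.memLp (.inl (k, r))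

lemma memLp_X [IsProbabilityMeasure μ] (k : Fin nt) : MemLp (fun ω => C.X ω k) 2 μ :=
  C.isCircular_decorrelated.memLp (.inr (.inr (.inl k)))

lemma memLp_Z [IsProbabilityMeasure μ] (r : Fin nr) : MemLp (fun ω => C.Z ω r) 2 μ :=
  C.isCircular_decorrelated.memLp (.inr (.inr (.inr r)))

lemma integral_err_mul [IsProbabilityMeasure μ] (φ : (Fin nt × Fin nr → ℂ) → ℂ)
    (ψ : (Fin nt ⊕ Fin nr → ℂ) → ℂ) (hφ : Measurable φ) (hψ : Measurable ψ) :
    ∫ ω, φ (fun p => C.err ω p.1 p.2) * ψ (fun q => C.decorrelated (.inr (.inr q)) ω) ∂μ =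
      (∫ ω, φ (fun p => C.err ω p.1 p.2) ∂μ) *
        ∫ ω, ψ (fun q => C.decorrelated (.inr (.inr q)) ω) ∂μ :=
  C.indepFun_err_signal.integral_fun_comp_mul_comp
    (measurable_pi_lambda _ fun p : Fin nt × Fin nr => C.measurable_err p.1 p.2).aemeasurable
    (measurable_pi_lambda _ fun _ => C.measurable_decorrelated _).aemeasurable
    hφ.aestronglyMeasurable hψ.aestronglyMeasurable

/-- A product of square integrable variables need not be square integrable; independence of error
and input makes it so. -/
lemma memLp_err_mul_X [IsProbabilityMeasure μ] (k : Fin nt) (r : Fin nr) :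
    MemLp (fun ω => C.err ω k r * C.X ω k) 2 μ := by
  rw [memLp_two_iff_integrable_sq_norm (by fun_prop)]
  have h : IndepFun (fun ω => ‖C.err ω k r‖ ^ 2) (fun ω => ‖C.X ω k‖ ^ 2) μ :=
    C.indepFun_err_signal.comp (φ := fun x : Fin nt × Fin nr → ℂ => ‖x (k, r)‖ ^ 2)
      (ψ := fun y : Fin nt ⊕ Fin nr → ℂ => ‖y (.inl k)‖ ^ 2)
      (((measurable_pi_apply _).norm).pow_const 2) (((measurable_pi_apply _).norm).pow_const 2)
  have := h.integrable_mul (C.memLp_err k r).norm.integrable_sq (C.memLp_X k).norm.integrable_sq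
  refine this.congr (ae_of_all _ fun ω => ?_)
  simp [mul_pow]

lemma memLp_signal [IsProbabilityMeasure μ] (j : Fin nt ⊕ Fin nr) : MemLp (C.signal j) 2 μ := by
  rcases j with k | r
  · exact C.memLp_X k
  · exact (memLp_finsetSum _ fun k _ => C.memLp_err_mul_X k r).add (C.memLp_Z r)

lemma integral_err [IsProbabilityMeasure μ] (k : Fin nt) (r : Fin nr) :
    ∫ ω, C.err ω k r ∂μ = 0 := C.isCircular_decorrelated.integral_eq_zero (.inl (k, r))

lemma integral_err_mul_conj [IsProbabilityMeasure μ] (k l : Fin nt) (r s : Fin nr) :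
    ∫ ω, C.err ω k r * conj (C.err ω l s) ∂μ =
      if k = l ∧ r = s then (C.errVar k : ℂ) else 0 := by
  have h := C.isCircular_decorrelated.integral_mul_conj (.inl (k, r)) (.inl (l, s))
  simpa [decorrelated, decorrelatedVar] using h

lemma integral_X_mul_conj [IsProbabilityMeasure μ] (k l : Fin nt) :
    ∫ ω, C.X ω k * conj (C.X ω l) ∂μ = if k = l then (C.P k : ℂ) else 0 := by
  have h := C.isCircular_decorrelated.integral_mul_conj (.inr (.inr (.inl k)))
    (.inr (.inr (.inl l)))
  simpa [decorrelated, decorrelatedVar] using h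

lemma integral_Z_mul_conj [IsProbabilityMeasure μ] (r s : Fin nr) :
    ∫ ω, C.Z ω r * conj (C.Z ω s) ∂μ = if r = s then (C.σ ^ 2 : ℂ) else 0 := by
  have h := C.isCircular_decorrelated.integral_mul_conj (.inr (.inr (.inr r)))
    (.inr (.inr (.inr s)))
  simpa [decorrelated, decorrelatedVar] using h

lemma integral_X_mul_conj_Z [IsProbabilityMeasure μ] (k : Fin nt) (r : Fin nr) :
    ∫ ω, C.X ω k * conj (C.Z ω r) ∂μ = 0 := by
  have h := C.isCircular_decorrelated.integral_mul_conj (.inr (.inr (.inl k)))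
    (.inr (.inr (.inr r)))
  simpa [decorrelated, decorrelatedVar] using h

/-- The noise contains `X`, yet each term carries a centered error factor independent of `(X, Z)`.
-/
lemma integral_X_mul_conj_noise [IsProbabilityMeasure μ] (k : Fin nt) (r : Fin nr) :
    ∫ ω, C.X ω k * conj (C.noise ω r) ∂μ = 0 := by
  have hint : ∀ l, Integrable (fun ω => C.X ω k * conj (C.err ω l r * C.X ω l)) μ := fun l =>
    integrable_mul_conj (C.memLp_X k) (C.memLp_err_mul_X l r)
  have h0 : ∀ l, ∫ ω, C.X ω k * conj (C.err ω l r * C.X ω l) ∂μ = 0 := by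
    intro l
    have h := C.integral_err_mul (fun x => conj (x (l, r)))
      (fun y => y (.inl k) * conj (y (.inl l)))
      (Complex.continuous_conj.measurable.comp (measurable_pi_apply _))
      ((measurable_pi_apply _).mul (Complex.continuous_conj.measurable.comp (measurable_pi_apply _)))
    simp only [decorrelated] at h
    rw [integral_conj_eq_zero (C.integral_err l r), zero_mul] at h
    rw [← h]
    congr 1
    ext ω
    rw [map_mul]
    ring
  have e : (fun ω => C.X ω k * conj (C.noise ω r)) = fun ω =>
      ∑ l, C.X ω k * conj (C.err ω l r * C.X ω l) + C.X ω k * conj (C.Z ω r) := by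
    ext ω
    rw [noise, map_add, map_sum, mul_add, Finset.mul_sum]
  rw [e, integral_add (integrable_finsetSum _ fun l _ => hint l)
    (integrable_mul_conj (C.memLp_X k) (C.memLp_Z r)), integral_finsetSum _ fun l _ => hint l,
    Finset.sum_congr rfl fun l _ => h0 l, integral_X_mul_conj_Z]
  simp

lemma b_eq : C.b = ∑ k, C.P k * C.errVar k + C.σ ^ 2 := by
  unfold b errVar pilotVar
  congr 1
  refine Finset.sum_congr rfl fun k _ => ?_
  ring

/-- Of the terms `err_k X_k` only equal indices survive and contribute `P_k errVar_k`; the mixed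
terms with `Z` vanish because the error is centered. The total is `b`. -/
lemma integral_noise_mul_conj [IsProbabilityMeasure μ] (r s : Fin nr) :
    ∫ ω, C.noise ω r * conj (C.noise ω s) ∂μ = if r = s then (C.b : ℂ) else 0 := by
  have hA : ∀ k r, MemLp (fun ω => C.err ω k r * C.X ω k) 2 μ := C.memLp_err_mul_X
  have h1 : ∀ k l, ∫ ω, (C.err ω k r * C.X ω k) * conj (C.err ω l s * C.X ω l) ∂μ =
      if k = l then (if r = s then ((C.P k * C.errVar k : ℝ) : ℂ) else 0) else 0 := by
    intro k l
    have h := C.integral_err_mul (fun x => x (k, r) * conj (x (l, s)))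
      (fun y => y (.inl k) * conj (y (.inl l)))
      ((measurable_pi_apply _).mul (Complex.continuous_conj.measurable.comp (measurable_pi_apply _)))
      ((measurable_pi_apply _).mul (Complex.continuous_conj.measurable.comp (measurable_pi_apply _)))
    simp only [decorrelated] at h
    rw [integral_err_mul_conj, integral_X_mul_conj] at h
    refine Eq.trans ?_ (h.trans ?_)
    · congr 1
      ext ω
      rw [map_mul]
      ring
    · by_cases hkl : k = l <;> by_cases hrs : r = s <;> simp [hkl, hrs, mul_comm]
  have h2 : ∀ k, ∫ ω, (C.err ω k r * C.X ω k) * conj (C.Z ω s) ∂μ = 0 := by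
    intro k
    have h := C.integral_err_mul (fun x => x (k, r)) (fun y => y (.inl k) * conj (y (.inr s)))
      (measurable_pi_apply _)
      ((measurable_pi_apply _).mul (Complex.continuous_conj.measurable.comp (measurable_pi_apply _)))
    simp only [decorrelated] at h
    rw [integral_err, zero_mul] at h
    rw [← h]
    congr 1
    ext ω
    ring
  have h3 : ∀ l, ∫ ω, C.Z ω r * conj (C.err ω l s * C.X ω l) ∂μ = 0 := by
    intro l
    have h := C.integral_err_mul (fun x => conj (x (l, s)))
      (fun y => y (.inr r) * conj (y (.inl l)))
      (Complex.continuous_conj.measurable.comp (measurable_pi_apply _))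
      ((measurable_pi_apply _).mul (Complex.continuous_conj.measurable.comp (measurable_pi_apply _)))
    simp only [decorrelated] at h
    rw [integral_conj_eq_zero (C.integral_err l s), zero_mul] at h
    rw [← h]
    congr 1
    ext ω
    rw [map_mul]
    ring
  have e : (fun ω => C.noise ω r * conj (C.noise ω s)) = fun ω =>
      (∑ k, ∑ l, (C.err ω k r * C.X ω k) * conj (C.err ω l s * C.X ω l))
        + (∑ k, (C.err ω k r * C.X ω k) * conj (C.Z ω s))
        + (∑ l, C.Z ω r * conj (C.err ω l s * C.X ω l)) + C.Z ω r * conj (C.Z ω s) := by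
    ext ω
    rw [noise, noise, map_add, map_sum, ← Finset.sum_mul_sum, ← Finset.sum_mul, ← Finset.mul_sum]
    ring
  have i1 : ∀ k l, Integrable
      (fun ω => (C.err ω k r * C.X ω k) * conj (C.err ω l s * C.X ω l)) μ := fun k l =>
    integrable_mul_conj (hA k r) (hA l s)
  have i2 : ∀ k, Integrable (fun ω => (C.err ω k r * C.X ω k) * conj (C.Z ω s)) μ := fun k =>
    integrable_mul_conj (hA k r) (C.memLp_Z s)
  have i3 : ∀ l, Integrable (fun ω => C.Z ω r * conj (C.err ω l s * C.X ω l)) μ := fun l =>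
    integrable_mul_conj (C.memLp_Z r) (hA l s)
  rw [e, integral_add_add_add
    (integrable_finsetSum _ fun k _ => integrable_finsetSum _ fun l _ => i1 k l)
    (integrable_finsetSum _ fun k _ => i2 k) (integrable_finsetSum _ fun l _ => i3 l)
    (integrable_mul_conj (C.memLp_Z r) (C.memLp_Z s)),
    integral_finsetSum _ fun k _ => integrable_finsetSum _ fun l _ => i1 k l,
    integral_finsetSum _ fun k _ => i2 k, integral_finsetSum _ fun l _ => i3 l,
    Finset.sum_congr rfl fun k _ => integral_finsetSum _ fun l _ => i1 k l]
  simp only [h1, h2, h3, integral_Z_mul_conj, Finset.sum_ite_eq, Finset.mem_univ, if_true,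
    Finset.sum_const_zero, add_zero]
  split_ifs with hrs
  · rw [b_eq]
    push_cast
    rfl
  · simp

lemma integral_signal_mul_conj [IsProbabilityMeasure μ] (j l : Fin nt ⊕ Fin nr) :
    ∫ ω, C.signal j ω * conj (C.signal l ω) ∂μ = if j = l then (C.signalVar j : ℂ) else 0 := by
  rcases j with k | r <;> rcases l with l | s <;> simp only [signal, signalVar, Sum.inl.injEq,
    Sum.inr.injEq, reduceCtorEq, if_false]
  · exact C.integral_X_mul_conj k l
  · exact C.integral_X_mul_conj_noise k s
  · have h := integral_conj_eq_zero (C.integral_X_mul_conj_noise l r)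
    rw [← h]
    congr 1
    ext ω
    rw [map_mul, Complex.conj_conj, mul_comm]
  · exact C.integral_noise_mul_conj r s

/-- `signal` is a function of the errors, the input and the noise `Z`, all of which are independent
of the pilot. Hence conditional second moments given the CSI are those of `signal` with frozen
coefficients. -/
lemma indepFun_Yp_signal [IsProbabilityMeasure μ] :
    IndepFun C.Yp (fun ω j => C.signal j ω) μ := by
  have h := C.indepFun_Yp_residual.comp (φ := id)
    (ψ := fun x (j : Fin nt ⊕ Fin nr) => Sum.elim (fun k => x (.inr (.inl k)))
      (fun r => ∑ k, x (.inl (k, r)) * x (.inr (.inl k)) + x (.inr (.inr r))) j)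
    measurable_id (by
      refine measurable_pi_lambda _ fun j => ?_
      rcases j with k | r <;> simp only [Sum.elim_inl, Sum.elim_inr] <;> fun_prop)
  have e : (fun ω j => C.signal j ω) = (fun x (j : Fin nt ⊕ Fin nr) =>
      Sum.elim (fun k => x (.inr (.inl k)))
        (fun r => ∑ k, x (.inl (k, r)) * x (.inr (.inl k)) + x (.inr (.inr r))) j) ∘
        C.residual := by
    ext ω j
    rcases j with k | r <;> rfl
  rw [e]
  exact h

end PilotChannel

namespace PilotChannel

variable {Ω : Type*} [MeasurableSpace Ω] {μ : Measure Ω} {nt nr : ℕ} (C : PilotChannel μ nt nr)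

/-! ### The conventional scheme -/

lemma pilotSigma_le : C.pilotSigma ≤ (inferInstance : MeasurableSpace Ω) :=
  C.measurable_Yp.comap_le

lemma measurable_residual : Measurable C.residual := by
  refine measurable_pi_lambda _ fun q => ?_
  rcases q with p | k | r <;> simp only [residual] <;> fun_prop

lemma condExp_comp_residual [IsProbabilityMeasure μ]
    {φ : ((Fin nt × Fin nr) ⊕ Fin nt ⊕ Fin nr → ℂ) → ℂ} (hφ : Measurable φ) :
    μ[fun ω => φ (C.residual ω) | C.pilotSigma] =ᵐ[μ]
      fun _ => ∫ ω, φ (C.residual ω) ∂μ := by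
  refine condExp_indep_eq (m₁ := MeasurableSpace.comap C.residual inferInstance)
    C.measurable_residual.comap_le C.pilotSigma_le ?_ C.indepFun_Yp_residual.symm
  exact (hφ.comp (comap_measurable C.residual)).stronglyMeasurable

lemma H_eq (ω : Ω) (r : Fin nr) (i : Fin nt) :
    C.H ω r i = C.err ω i r + C.mmseCoeff i * C.Yp ω i r := by
  simp [H, err]

lemma memLp_Yp [IsProbabilityMeasure μ] (i : Fin nt) (r : Fin nr) :
    MemLp (fun ω => C.Yp ω i r) 2 μ := C.isCircular_decorrelated.memLp (.inr (.inl (i, r)))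

/-- In `H = err + c Y_p` the second term is pilot-measurable and the first is independent of the
pilot and centered, so the linear estimate is the conditional mean. -/
lemma Hhat_ae_eq [IsProbabilityMeasure μ] :
    ∀ᵐ ω ∂μ, C.Hhat ω = Matrix.of fun r i => C.mmseCoeff i * C.Yp ω i r := by
  have h : ∀ r i, ∀ᵐ ω ∂μ, (μ[fun ω' => C.H ω' r i | C.pilotSigma]) ω =
      C.mmseCoeff i * C.Yp ω i r := by
    intro r i
    have hY : Integrable (fun ω => C.mmseCoeff i * C.Yp ω i r) μ :=
      ((C.memLp_Yp i r).integrable (by norm_num)).const_mul _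
    have h1 := condExp_add ((C.memLp_err i r).integrable (by norm_num)) hY C.pilotSigma
    have h2 := C.condExp_comp_residual (φ := fun x => x (.inl (i, r))) (measurable_pi_apply _)
    simp only [residual, integral_err] at h2
    have h3 : μ[fun ω => C.mmseCoeff i * C.Yp ω i r | C.pilotSigma] =
        fun ω => C.mmseCoeff i * C.Yp ω i r := by
      refine condExp_of_stronglyMeasurable C.pilotSigma_le ?_ hY
      have hm : Measurable fun v : CSI nt nr => C.mmseCoeff i * v i r := by fun_prop
      exact (hm.comp (comap_measurable C.Yp)).stronglyMeasurable
    have e : (fun ω' => C.H ω' r i) =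
        (fun ω => C.err ω i r) + fun ω => C.mmseCoeff i * C.Yp ω i r := by
      ext ω
      exact C.H_eq ω r i
    rw [e]
    filter_upwards [h1, h2] with ω hω1 hω2
    rw [hω1, Pi.add_apply, hω2, h3, zero_add]
  filter_upwards [ae_all_iff.2 fun r => ae_all_iff.2 fun i => h r i] with ω hω
  ext r i
  exact hω r i

lemma Htilde_ae_eq [IsProbabilityMeasure μ] :
    ∀ᵐ ω ∂μ, C.Htilde ω = Matrix.of fun r i => C.err ω i r := by
  filter_upwards [C.Hhat_ae_eq] with ω hω
  ext r i
  rw [Htilde, hω, Matrix.sub_apply, H_eq, Matrix.of_apply, Matrix.of_apply, add_sub_cancel_right]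

lemma Ztilde_ae_eq [IsProbabilityMeasure μ] : ∀ᵐ ω ∂μ, C.Ztilde ω = C.noise ω := by
  filter_upwards [C.Htilde_ae_eq] with ω hω
  ext r
  rw [Ztilde, hω]
  rfl

lemma smul_one_apply (r s : Fin nr) :
    ((C.b : ℂ) • (1 : Matrix (Fin nr) (Fin nr) ℂ)) r s = if r = s then (C.b : ℂ) else 0 := by
  simp [Matrix.one_apply]

lemma covZtilde_ae_eq [IsProbabilityMeasure μ] :
    ∀ᵐ ω ∂μ, C.covZtilde ω = (C.b : ℂ) • (1 : Matrix (Fin nr) (Fin nr) ℂ) := by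
  have h : ∀ r s, ∀ᵐ ω ∂μ,
      (μ[fun ω' => C.Ztilde ω' r * conj (C.Ztilde ω' s) | C.pilotSigma]) ω =
        if r = s then (C.b : ℂ) else 0 := by
    intro r s
    have h1 : (fun ω' => C.Ztilde ω' r * conj (C.Ztilde ω' s)) =ᵐ[μ]
        fun ω' => C.noise ω' r * conj (C.noise ω' s) := by
      filter_upwards [C.Ztilde_ae_eq] with ω hω
      rw [hω]
    have h2 := C.condExp_comp_residual
      (φ := fun x => (∑ k, x (.inl (k, r)) * x (.inr (.inl k)) + x (.inr (.inr r))) *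
        conj (∑ k, x (.inl (k, s)) * x (.inr (.inl k)) + x (.inr (.inr s))))
      (Measurable.mul (by fun_prop) (Complex.continuous_conj.measurable.comp (by fun_prop)))
    have h3 := C.integral_noise_mul_conj r s
    filter_upwards [condExp_congr_ae h1, h2] with ω hω1 hω2
    rw [hω1, ← h3]
    exact hω2
  filter_upwards [ae_all_iff.2 fun r => ae_all_iff.2 fun s => h r s] with ω hω
  ext r s
  rw [smul_one_apply]
  exact hω r s

lemma Kz_ae_eq [IsProbabilityMeasure μ] :
    ∀ᵐ ω ∂μ, C.Kz ω = (C.b : ℂ) • (1 : Matrix (Fin nr) (Fin nr) ℂ) := by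
  have h : ∀ r s, ∀ᵐ ω ∂μ,
      (μ[fun ω' => (C.Htilde ω' * C.Kx * (C.Htilde ω')ᴴ
        + Matrix.vecMulVec (C.Z ω') (star (C.Z ω'))) r s | C.pilotSigma]) ω =
        if r = s then (C.b : ℂ) else 0 := by
    intro r s
    have h1 : (fun ω' => (C.Htilde ω' * C.Kx * (C.Htilde ω')ᴴ
        + Matrix.vecMulVec (C.Z ω') (star (C.Z ω'))) r s) =ᵐ[μ]
        fun ω' => ∑ k, (C.P k : ℂ) * (C.err ω' k r * conj (C.err ω' k s))
          + C.Z ω' r * conj (C.Z ω' s) := by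
      filter_upwards [C.Htilde_ae_eq] with ω hω
      rw [hω, Kx, Matrix.add_apply, Matrix.vecMulVec_apply, Matrix.mul_apply]
      simp only [Matrix.mul_diagonal, Matrix.conjTranspose_apply, Matrix.of_apply, Pi.star_apply,
        RCLike.star_def]
      congr 1
      refine Finset.sum_congr rfl fun k _ => ?_
      ring
    have h2 := C.condExp_comp_residual
      (φ := fun x => ∑ k, (C.P k : ℂ) * (x (.inl (k, r)) * conj (x (.inl (k, s))))
        + x (.inr (.inr r)) * conj (x (.inr (.inr s))))
      (Measurable.add (Finset.measurable_sum _ fun k _ => ((measurable_pi_apply _).mul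
        (Complex.continuous_conj.measurable.comp (measurable_pi_apply _))).const_mul _)
        ((measurable_pi_apply _).mul
        (Complex.continuous_conj.measurable.comp (measurable_pi_apply _))))
    have hi : ∀ k, Integrable
        (fun ω => (C.P k : ℂ) * (C.err ω k r * conj (C.err ω k s))) μ := fun k =>
      (integrable_mul_conj (C.memLp_err k r) (C.memLp_err k s)).const_mul _
    have h3 : ∫ ω, (∑ k, (C.P k : ℂ) * (C.err ω k r * conj (C.err ω k s))
          + C.Z ω r * conj (C.Z ω s)) ∂μ = if r = s then (C.b : ℂ) else 0 := by
      rw [integral_add (integrable_finsetSum _ fun k _ => hi k)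
        (integrable_mul_conj (C.memLp_Z r) (C.memLp_Z s)), integral_finsetSum _ fun k _ => hi k]
      simp only [integral_const_mul, integral_err_mul_conj, integral_Z_mul_conj, true_and]
      split_ifs with hrs
      · rw [b_eq]
        push_cast
        rfl
      · simp
    filter_upwards [condExp_congr_ae h1, h2] with ω hω1 hω2
    rw [hω1, ← h3]
    exact hω2
  filter_upwards [ae_all_iff.2 fun r => ae_all_iff.2 fun s => h r s] with ω hω
  ext r s
  rw [smul_one_apply]
  exact hω r s

/-! ### Identification and integrability of the information densities -/

lemma a_eq (i : Fin nt) : C.a i = C.P i * ‖C.mmseCoeff i‖ ^ 2 := by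
  have h := C.pilotVar_pos i
  have h1 : ‖C.mmseCoeff i‖ = C.η i ^ 2 * ‖C.xp‖ / C.pilotVar i := by
    rw [mmseCoeff, norm_div, norm_mul, RCLike.norm_conj, norm_pow, Complex.norm_real,
      Complex.norm_real, Real.norm_eq_abs, Real.norm_eq_abs, sq_abs, abs_of_pos h]
  rw [h1, a, ← pilotVar]
  field_simp

lemma a_nonneg (i : Fin nt) : 0 ≤ C.a i := by
  rw [a_eq]
  have := C.P_pos i
  positivity

lemma b_pos : 0 < C.b := by
  rw [b_eq]
  have h1 := C.σ_pos
  have : 0 ≤ ∑ k, C.P k * C.errVar k := Finset.sum_nonneg fun k _ =>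
    mul_nonneg (C.P_pos k).le (div_nonneg (by positivity) (C.pilotVar_pos k).le)
  positivity

lemma substreamInfo_eq (i : Fin nt) (ω : Ω) :
    C.substreamInfo i ω =
      Real.log (1 + C.a i * quality C.a C.b (Finset.Ioi i) (C.Yp ω) i) := by
  rw [substreamInfo, quality, Complex.add_re, Complex.one_re, Complex.re_ofReal_mul]
  rfl

lemma sumInfo_eq_log_det (ω : Ω) :
    C.sumInfo ω =
      Real.log ((interference C.a C.b Finset.univ (C.Yp ω)).det.re / C.b ^ nr) := by
  have hb : (C.b : ℂ) ≠ 0 := by exact_mod_cast C.b_pos.ne'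
  have h : (1 + ∑ i, ((C.a i / C.b : ℝ) : ℂ) • C.pilotOuter i ω) =
      ((C.b⁻¹ : ℝ) : ℂ) • interference C.a C.b Finset.univ (C.Yp ω) := by
    rw [interference, smul_add, smul_smul, Finset.smul_sum, add_comm]
    push_cast
    rw [inv_mul_cancel₀ hb, one_smul]
    congr 1
    refine Finset.sum_congr rfl fun i _ => ?_
    rw [smul_smul, div_eq_inv_mul]
    rfl
  rw [sumInfo, h, Matrix.det_smul, Fintype.card_fin, ← Complex.ofReal_pow, Complex.re_ofReal_mul,
    inv_pow, inv_mul_eq_div]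

lemma sumInfo_eq_sum (ω : Ω) : C.sumInfo ω = ∑ i, C.substreamInfo i ω := by
  simp only [substreamInfo_eq]
  rw [sum_log_one_add_quality C.a_nonneg C.b_pos, sumInfo_eq_log_det, Fintype.card_fin]

/-- Column `k` of `Ĥ` is `c_k Y_{p,k}`, and `P_k |c_k|² = a_k`, so `Ĥ K_x Ĥ^*` is the sum of the
scaled pilot outer products. -/
lemma conventionalInfo_ae_eq [IsProbabilityMeasure μ] : C.conventionalInfo =ᵐ[μ] C.sumInfo := by
  filter_upwards [C.Kz_ae_eq, C.Hhat_ae_eq] with ω hK hH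
  have hb : (C.b : ℂ) ≠ 0 := by exact_mod_cast C.b_pos.ne'
  have hinv : ((C.b : ℂ) • (1 : Matrix (Fin nr) (Fin nr) ℂ))⁻¹ = (C.b : ℂ)⁻¹ • 1 := by
    refine Matrix.inv_eq_left_inv ?_
    rw [smul_mul_smul_comm, inv_mul_cancel₀ hb, one_mul, one_smul]
  rw [conventionalInfo, sumInfo, hK, hinv, hH]
  congr 3
  ext r s
  rw [Matrix.smul_mul, Matrix.one_mul, Matrix.add_apply, Matrix.add_apply, Kx, Matrix.mul_apply,
    Matrix.sum_apply]
  congr 1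
  refine Finset.sum_congr rfl fun k _ => ?_
  rw [Matrix.mul_diagonal, Matrix.smul_apply, Matrix.smul_apply, Matrix.conjTranspose_apply,
    Matrix.of_apply, Matrix.of_apply, pilotOuter, Matrix.vecMulVec_apply, Pi.star_apply, a_eq,
    smul_eq_mul, smul_eq_mul, star_mul']
  have hn : ((‖C.mmseCoeff k‖ : ℂ)) ^ 2 = C.mmseCoeff k * star (C.mmseCoeff k) := by
    rw [RCLike.star_def, Complex.mul_conj, Complex.normSq_eq_norm_sq]
    push_cast
    rfl
  push_cast
  rw [hn]
  ring

/-- Domination by `log (1 + x) ≤ x` and `quality_le`, the entries of the pilot being square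
integrable. -/
lemma integrable_substreamInfo [IsProbabilityMeasure μ] (i : Fin nt) :
    Integrable (C.substreamInfo i) μ := by
  have hq : ∀ ω, 0 ≤ C.a i * quality C.a C.b (Finset.Ioi i) (C.Yp ω) i := fun ω =>
    mul_nonneg (C.a_nonneg i) (quality_nonneg C.a_nonneg C.b_pos _ _ _)
  have hint : Integrable (fun ω => C.a i * (C.b⁻¹ * ∑ r, ‖C.Yp ω i r‖ ^ 2)) μ :=
    ((integrable_finsetSum _ fun r _ => (C.memLp_Yp i r).norm.integrable_sq).const_mul _).const_mul _
  have hm : Measurable fun ω =>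
      Real.log (1 + C.a i * quality C.a C.b (Finset.Ioi i) (C.Yp ω) i) :=
    ((((measurable_quality C.a C.b (Finset.Ioi i) i).comp C.measurable_Yp).const_mul _).const_add
      _).log
  rw [show C.substreamInfo i = _ from funext (C.substreamInfo_eq i)]
  refine hint.mono' hm.aestronglyMeasurable (ae_of_all _ fun ω => ?_)
  have h1 := hq ω
  rw [Real.norm_of_nonneg (Real.log_nonneg (by linarith))]
  have h2 := Real.log_le_sub_one_of_pos (show 0 < 1 + C.a i * quality C.a C.b (Finset.Ioi i)
    (C.Yp ω) i by linarith)
  have h3 := mul_le_mul_of_nonneg_left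
    (quality_le C.a_nonneg C.b_pos (Finset.Ioi i) (C.Yp ω) i) (C.a_nonneg i)
  linarith

lemma integrable_sumInfo [IsProbabilityMeasure μ] : Integrable C.sumInfo μ := by
  rw [show C.sumInfo = _ from funext C.sumInfo_eq_sum]
  exact integrable_finsetSum _ fun i _ => C.integrable_substreamInfo i

lemma integral_sumInfo [IsProbabilityMeasure μ] :
    ∫ ω, C.sumInfo ω ∂μ = ∑ i, ∫ ω, C.substreamInfo i ω ∂μ := by
  simp only [sumInfo_eq_sum]
  exact integral_finsetSum _ fun i _ => C.integrable_substreamInfo i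

end PilotChannel

/-! ### Optimization of the generalized mutual information -/

/-- The left side is the conditional rate for fixed CSI, with signal gain `u`, residual power `s`
and scaling `f`; `κ` bounds the ratio of signal to residual power. Equality occurs for `u = f`, `-θ
s = 1` and `P |u|² = κ s`. -/
lemma rate_le {P θ s κ : ℝ} (hP : 0 < P) (hθ : θ < 0) (hs : 0 ≤ s) (hκ : 0 ≤ κ) (u f : ℂ)
    (h : P * ‖u‖ ^ 2 ≤ κ * s) :
    θ * (s + P * ‖u - f‖ ^ 2) - (θ * (s + P * ‖u‖ ^ 2) / (1 - θ * P * ‖f‖ ^ 2)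
      - Real.log (1 - θ * P * ‖f‖ ^ 2)) ≤ Real.log (1 + κ) := by
  obtain ⟨t, ht⟩ : ∃ t, t = -θ := ⟨_, rfl⟩
  obtain rfl : θ = -t := by rw [ht, neg_neg]
  have ht0 : 0 < t := by linarith
  set x : ℝ := t * P * ‖u‖ ^ 2 with hx
  set τ : ℝ := t * P * ‖f‖ ^ 2 with hτ
  set y : ℝ := t * P * (‖u‖ * ‖f‖) with hy
  set q : ℝ := t * s with hq
  have hx0 : 0 ≤ x := by positivity
  have hτ0 : 0 ≤ τ := by positivity
  have hy0 : 0 ≤ y := by positivity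
  have hq0 : 0 ≤ q := by positivity
  have hyx : y ^ 2 = x * τ := by rw [hy, hx, hτ]; ring
  have hxq : x ≤ κ * q := by
    have := mul_le_mul_of_nonneg_left h ht0.le
    calc x = t * (P * ‖u‖ ^ 2) := by rw [hx]; ring
      _ ≤ t * (κ * s) := this
      _ = κ * q := by rw [hq]; ring
  have h1τ : (0 : ℝ) < 1 + τ := by linarith
  have h1κ : (0 : ℝ) < 1 + κ := by linarith
  have hsub : x + τ - 2 * y ≤ t * P * ‖u - f‖ ^ 2 := by
    have h1 : (‖u‖ - ‖f‖) ^ 2 ≤ ‖u - f‖ ^ 2 := by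
      rw [← sq_abs (‖u‖ - ‖f‖)]
      exact pow_le_pow_left₀ (abs_nonneg _) (abs_norm_sub_norm_le u f) 2
    have h2 := mul_le_mul_of_nonneg_left h1 (by positivity : 0 ≤ t * P)
    calc x + τ - 2 * y = t * P * (‖u‖ - ‖f‖) ^ 2 := by rw [hx, hτ, hy]; ring
      _ ≤ _ := h2
  -- Tangent of the logarithm at `1 + κ`, the value of `1 + τ` in the case of equality.
  have hlog : Real.log (1 + τ) - Real.log (1 + κ) ≤ (τ - κ) / (1 + κ) := by
    rw [← Real.log_div h1τ.ne' h1κ.ne']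
    refine (Real.log_le_sub_one_of_pos (by positivity)).trans_eq ?_
    field_simp
    ring
  -- Arithmetic–geometric mean: `y² = x τ ≤ A B` is, up to the factor `τ`, the hypothesis `x ≤ κ q`.
  have hamgm : 2 * y ≤ (q + x) * τ / (1 + τ) + κ * (1 + τ) / (1 + κ) := by
    set A := (q + x) * τ / (1 + τ) with hA
    set B := κ * (1 + τ) / (1 + κ) with hB
    have hA0 : 0 ≤ A := by positivity
    have hB0 : 0 ≤ B := by positivity
    have hAB : A * B = (q + x) * κ * τ / (1 + κ) := by
      rw [hA, hB]
      field_simp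
    have h2 : y ^ 2 ≤ A * B := by
      rw [hAB, hyx, le_div_iff₀ h1κ]
      have := mul_le_mul_of_nonneg_right hxq hτ0
      linarith
    have h3 : (2 * y) ^ 2 ≤ (A + B) ^ 2 := by nlinarith [sq_nonneg (A - B)]
    exact le_of_sq_le_sq h3 (by positivity)
  have e1 : 1 - -t * P * ‖f‖ ^ 2 = 1 + τ := by rw [hτ]; ring
  have e2 : -t * (s + P * ‖u - f‖ ^ 2) = -q - t * P * ‖u - f‖ ^ 2 := by rw [hq]; ring
  have e3 : -t * (s + P * ‖u‖ ^ 2) = -(q + x) := by rw [hq, hx]; ring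
  rw [e1, e2, e3]
  have e4 : -(q + x) / (1 + τ) = -(q + x) + (q + x) * τ / (1 + τ) := by
    field_simp
    ring
  have e5 : (τ - κ) / (1 + κ) = τ - κ * (1 + τ) / (1 + κ) := by
    field_simp
    ring
  rw [e4]
  rw [e5] at hlog
  linarith

/-- `A` and `B` stand for the conditional second moments of the error and of the output given the
CSI. They may replace the original squares under the integral, after which a pointwise bound
suffices. -/
lemma gmi_le {Ω : Type*} [MeasurableSpace Ω] {μ : Measure Ω} [IsProbabilityMeasure μ]
    {p : ℝ} (hp : 0 < p) {G F X : Ω → ℂ} {A B I : Ω → ℝ}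
    (hG : Measurable G) (hF : Measurable F) (hX : Measurable X)
    (hAm : Measurable A) (hBm : Measurable B) (hA0 : ∀ ω, 0 ≤ A ω) (hB0 : ∀ ω, 0 ≤ B ω)
    (hA : ∫⁻ ω, ENNReal.ofReal (‖G ω - F ω * X ω‖ ^ 2) ∂μ = ∫⁻ ω, ENNReal.ofReal (A ω) ∂μ)
    (hB : ∀ θ < 0, ∫⁻ ω, ENNReal.ofReal (-θ / (1 - θ * p * ‖F ω‖ ^ 2) * ‖G ω‖ ^ 2) ∂μ =
      ∫⁻ ω, ENNReal.ofReal (-θ / (1 - θ * p * ‖F ω‖ ^ 2) * B ω) ∂μ)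
    (hI : Integrable I μ)
    (hle : ∀ θ < 0, ∀ ω, θ * A ω - (θ * B ω / (1 - θ * p * ‖F ω‖ ^ 2)
      - Real.log (1 - θ * p * ‖F ω‖ ^ 2)) ≤ I ω) :
    gmi μ p G F X ≤ ((∫ ω, I ω ∂μ : ℝ) : EReal) := by
  refine sSup_le ?_
  rintro _ ⟨hint, θ, hθ, Λ, hΛ, rfl⟩
  obtain ⟨hφ, rfl⟩ := (isLimitLogMGF_iff μ hp hθ hG hF Λ).1 hΛ
  have hden : ∀ ω, 1 ≤ 1 - θ * p * ‖F ω‖ ^ 2 := fun ω => one_le_one_sub hp hθ (F ω)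
  have hw0 : ∀ ω, 0 ≤ -θ / (1 - θ * p * ‖F ω‖ ^ 2) := fun ω =>
    div_nonneg (by linarith) (by linarith [hden ω])
  obtain ⟨hiA, heA⟩ := integrable_and_integral_eq_of_lintegral_eq (μ := μ)
    (f := fun ω => ‖G ω - F ω * X ω‖ ^ 2) (by fun_prop) hAm (fun ω => sq_nonneg _) hA0 hA
  obtain ⟨hiB, heB⟩ := integrable_and_integral_eq_of_lintegral_eq (μ := μ)
    (f := fun ω => -θ / (1 - θ * p * ‖F ω‖ ^ 2) * ‖G ω‖ ^ 2)
    (g := fun ω => -θ / (1 - θ * p * ‖F ω‖ ^ 2) * B ω) (by fun_prop) (by fun_prop)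
    (fun ω => mul_nonneg (hw0 ω) (sq_nonneg _)) (fun ω => mul_nonneg (hw0 ω) (hB0 ω)) (hB θ hθ)
  have hφeq : ∀ ω, symbolLogMGF p θ (G ω) (F ω) =
      -(-θ / (1 - θ * p * ‖F ω‖ ^ 2) * ‖G ω‖ ^ 2) - Real.log (1 - θ * p * ‖F ω‖ ^ 2) := by
    intro ω
    rw [symbolLogMGF]
    ring
  have hlog0 : ∀ ω, 0 ≤ Real.log (1 - θ * p * ‖F ω‖ ^ 2) := fun ω => Real.log_nonneg (hden ω)
  -- Both parts of `symbolLogMGF` are nonpositive, so each inherits integrability from the sum.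
  have hi1 : Integrable (fun ω => -θ / (1 - θ * p * ‖F ω‖ ^ 2) * ‖G ω‖ ^ 2) μ := by
    refine hφ.mono (by fun_prop) (ae_of_all _ fun ω => ?_)
    have h1 := mul_nonneg (hw0 ω) (sq_nonneg ‖G ω‖)
    rw [Real.norm_of_nonneg h1, Real.norm_of_nonpos (symbolLogMGF_nonpos hp hθ _ _), hφeq]
    linarith [hlog0 ω]
  have hi2 : Integrable (fun ω => Real.log (1 - θ * p * ‖F ω‖ ^ 2)) μ := by
    refine hφ.mono (Measurable.log (by fun_prop)).aestronglyMeasurable (ae_of_all _ fun ω => ?_)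
    have h1 := mul_nonneg (hw0 ω) (sq_nonneg ‖G ω‖)
    rw [Real.norm_of_nonneg (hlog0 ω), Real.norm_of_nonpos (symbolLogMGF_nonpos hp hθ _ _), hφeq]
    linarith
  have hiA' := hiA.1 hint
  have hiB' := hiB.1 hi1
  have hφint : ∫ ω, symbolLogMGF p θ (G ω) (F ω) ∂μ =
      -∫ ω, -θ / (1 - θ * p * ‖F ω‖ ^ 2) * B ω ∂μ
        - ∫ ω, Real.log (1 - θ * p * ‖F ω‖ ^ 2) ∂μ := by
    rw [← heB, ← integral_neg, ← integral_sub hi1.fun_neg hi2]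
    exact integral_congr_ae (ae_of_all _ hφeq)
  have hi3 : Integrable (fun ω => -(-θ / (1 - θ * p * ‖F ω‖ ^ 2) * B ω)
      - Real.log (1 - θ * p * ‖F ω‖ ^ 2)) μ := hiB'.fun_neg.sub hi2
  rw [EReal.coe_le_coe_iff, heA, hφint, ← integral_const_mul, ← integral_neg,
    ← integral_sub hiB'.fun_neg hi2, ← integral_sub (hiA'.const_mul θ) hi3]
  refine integral_mono ((hiA'.const_mul θ).sub hi3) hI fun ω => ?_
  refine le_trans (le_of_eq ?_) (hle θ hθ ω)
  ring

/-- At `θ = -1` the hypothesis `hAB` turns the weighted output power into `A`, which cancels the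
error power and leaves `I`. The bound `A ≤ 1` provides integrability. -/
lemma le_gmi {Ω : Type*} [MeasurableSpace Ω] {μ : Measure Ω} [IsProbabilityMeasure μ]
    {p : ℝ} (hp : 0 < p) {G F X : Ω → ℂ} {A B I : Ω → ℝ}
    (hG : Measurable G) (hF : Measurable F) (hX : Measurable X)
    (hAm : Measurable A) (hBm : Measurable B) (hA0 : ∀ ω, 0 ≤ A ω) (hB0 : ∀ ω, 0 ≤ B ω)
    (hA : ∫⁻ ω, ENNReal.ofReal (‖G ω - F ω * X ω‖ ^ 2) ∂μ = ∫⁻ ω, ENNReal.ofReal (A ω) ∂μ)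
    (hB : ∀ θ < 0, ∫⁻ ω, ENNReal.ofReal (-θ / (1 - θ * p * ‖F ω‖ ^ 2) * ‖G ω‖ ^ 2) ∂μ =
      ∫⁻ ω, ENNReal.ofReal (-θ / (1 - θ * p * ‖F ω‖ ^ 2) * B ω) ∂μ)
    (hI : Integrable I μ) (hA1 : ∀ ω, A ω ≤ 1) (hFI : ∀ ω, Real.log (1 + p * ‖F ω‖ ^ 2) = I ω)
    (hAB : ∀ ω, B ω = (1 + p * ‖F ω‖ ^ 2) * A ω) :
    ((∫ ω, I ω ∂μ : ℝ) : EReal) ≤ gmi μ p G F X := by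
  have hθ : (-1 : ℝ) < 0 := by norm_num
  have hden : ∀ ω, 1 - -1 * p * ‖F ω‖ ^ 2 = 1 + p * ‖F ω‖ ^ 2 := fun ω => by ring
  have hpos : ∀ ω, 0 < 1 + p * ‖F ω‖ ^ 2 := fun ω => by positivity
  have hw0 : ∀ ω, 0 ≤ - -1 / (1 - -1 * p * ‖F ω‖ ^ 2) := fun ω => by
    rw [hden]
    exact div_nonneg (by norm_num) (hpos ω).le
  have hwB : ∀ ω, - -1 / (1 - -1 * p * ‖F ω‖ ^ 2) * B ω = A ω := fun ω => by
    have := (hpos ω).ne'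
    rw [hden, hAB]
    field_simp
  have hiA' : Integrable A μ :=
    Integrable.of_bound hAm.aestronglyMeasurable 1 (ae_of_all _ fun ω => by
      rw [Real.norm_of_nonneg (hA0 ω)]
      exact hA1 ω)
  obtain ⟨hiA, heA⟩ := integrable_and_integral_eq_of_lintegral_eq (μ := μ)
    (f := fun ω => ‖G ω - F ω * X ω‖ ^ 2) (by fun_prop) hAm (fun ω => sq_nonneg _) hA0 hA
  obtain ⟨hiB, heB⟩ := integrable_and_integral_eq_of_lintegral_eq (μ := μ)
    (f := fun ω => - -1 / (1 - -1 * p * ‖F ω‖ ^ 2) * ‖G ω‖ ^ 2)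
    (g := fun ω => - -1 / (1 - -1 * p * ‖F ω‖ ^ 2) * B ω) (by fun_prop) (by fun_prop)
    (fun ω => mul_nonneg (hw0 ω) (sq_nonneg _)) (fun ω => mul_nonneg (hw0 ω) (hB0 ω)) (hB _ hθ)
  simp only [hwB] at hiB heB
  have hφeq : (fun ω => symbolLogMGF p (-1) (G ω) (F ω)) =
      fun ω => -(- -1 / (1 - -1 * p * ‖F ω‖ ^ 2) * ‖G ω‖ ^ 2) - I ω := by
    ext ω
    rw [symbolLogMGF, ← hFI, hden]
    ring
  have hφ : Integrable (fun ω => symbolLogMGF p (-1) (G ω) (F ω)) μ := by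
    rw [hφeq]
    exact (hiB.2 hiA').neg.sub hI
  refine le_sSup ⟨hiA.2 hiA', -1, hθ, _, (isLimitLogMGF_iff μ hp hθ hG hF _).2 ⟨hφ, rfl⟩, ?_⟩
  rw [EReal.coe_eq_coe_iff, hφeq, heA, integral_sub (hiB.2 hiA').fun_neg hI, integral_neg, heB]
  ring

/-! ### Linear receivers: second moments, converse and optimal receiver -/

namespace PilotChannel

variable {Ω : Type*} [MeasurableSpace Ω] {μ : Measure Ω} {nt nr : ℕ} (C : PilotChannel μ nt nr)
  (R : LinearReceiver nt nr) (i : Fin nt)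

/-- The gain of the symbol `X_k` in the output of the processing function of substream `i`. -/
def gain (v : CSI nt nr) (k : Fin nt) : ℂ :=
  C.mmseCoeff k * (star (R.β i v) ⬝ᵥ v k) - if k < i then star (R.β i v) ⬝ᵥ R.γ k v else 0

/-- Coefficients of the processing function in terms of `signal`. -/
def weight (v : CSI nt nr) : Fin nt ⊕ Fin nr → ℂ :=
  Sum.elim (C.gain R i v) (fun r => conj (R.β i v r))

/-- Coefficients of the decision error in terms of `signal`. -/
def errorWeight (v : CSI nt nr) : Fin nt ⊕ Fin nr → ℂ :=
  Sum.elim (fun k => C.gain R i v k - if k = i then R.f i v else 0) (fun r => conj (R.β i v r))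

/-- Conditional second moment of the interference and the noise after processing. -/
def residualPower (v : CSI nt nr) : ℝ :=
  ∑ k ∈ Finset.univ.erase i, C.P k * ‖C.gain R i v k‖ ^ 2 + C.b * ∑ r, ‖R.β i v r‖ ^ 2

lemma sum_Iio (x : Fin nt → ℂ) (γ : Fin nt → Fin nr → ℂ) :
    ∑ k : Set.Iio i, x k • γ k = ∑ k, if k < i then x k • γ k else 0 := by
  rw [← Finset.sum_filter]
  exact (Finset.sum_subtype (p := fun k => k ∈ Set.Iio i) (Finset.univ.filter (· < i)) (by simp)
    fun k => x k • γ k).symm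

lemma Y_apply (ω : Ω) (r : Fin nr) :
    C.Y ω r = ∑ k, C.X ω k * (C.mmseCoeff k * C.Yp ω k r) + C.noise ω r := by
  have h : (C.H ω *ᵥ C.X ω) r = ∑ k, (C.err ω k r * C.X ω k
      + C.X ω k * (C.mmseCoeff k * C.Yp ω k r)) := by
    rw [Matrix.mulVec, dotProduct]
    refine Finset.sum_congr rfl fun k _ => ?_
    rw [H_eq]
    ring
  rw [Y, Pi.add_apply, h, Finset.sum_add_distrib, noise]
  ring

lemma g_eq (ω : Ω) :
    R.g i (C.Y ω) (C.Yp ω) (fun k => C.X ω k) =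
      ∑ j, C.weight R i (C.Yp ω) j * C.signal j ω := by
  have hY : C.Y ω = ∑ k, C.X ω k • (C.mmseCoeff k • C.Yp ω k) + C.noise ω := by
    ext r
    rw [Y_apply, Pi.add_apply, Finset.sum_apply]
    rfl
  rw [LinearReceiver.g, sum_Iio i (C.X ω) (fun k => R.γ k (C.Yp ω)), hY, Fintype.sum_sum_type,
    add_sub_right_comm, ← Finset.sum_sub_distrib, dotProduct_add, dotProduct_sum]
  congr 1
  refine Finset.sum_congr rfl fun k _ => ?_
  simp only [weight, gain, Sum.elim_inl, signal]
  split_ifs with h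
  · rw [dotProduct_sub, dotProduct_smul, dotProduct_smul, dotProduct_smul]
    simp only [smul_eq_mul]
    ring
  · rw [sub_zero, sub_zero, dotProduct_smul, dotProduct_smul]
    simp only [smul_eq_mul]
    ring

lemma error_eq (ω : Ω) :
    R.g i (C.Y ω) (C.Yp ω) (fun k => C.X ω k) - R.f i (C.Yp ω) * C.X ω i =
      ∑ j, C.errorWeight R i (C.Yp ω) j * C.signal j ω := by
  rw [g_eq, Fintype.sum_sum_type, Fintype.sum_sum_type, add_sub_right_comm]
  congr 1
  simp only [weight, errorWeight, Sum.elim_inl, signal, sub_mul, ite_mul, zero_mul,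
    Finset.sum_sub_distrib, Finset.sum_ite_eq', Finset.mem_univ, if_true]

lemma sum_weight (v : CSI nt nr) :
    ∑ j, C.signalVar j * ‖C.weight R i v j‖ ^ 2 =
      C.residualPower R i v + C.P i * ‖C.gain R i v i‖ ^ 2 := by
  rw [Fintype.sum_sum_type, residualPower, ← Finset.add_sum_erase _ _ (Finset.mem_univ i)]
  simp only [signalVar, weight, Sum.elim_inl, Sum.elim_inr, RCLike.norm_conj, ← Finset.mul_sum]
  ring

lemma sum_errorWeight (v : CSI nt nr) :
    ∑ j, C.signalVar j * ‖C.errorWeight R i v j‖ ^ 2 =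
      C.residualPower R i v + C.P i * ‖C.gain R i v i - R.f i v‖ ^ 2 := by
  rw [Fintype.sum_sum_type, residualPower, ← Finset.add_sum_erase _ _ (Finset.mem_univ i)]
  have h : ∀ k ∈ Finset.univ.erase i, C.signalVar (.inl k : Fin nt ⊕ Fin nr) *
      ‖C.errorWeight R i v (.inl k)‖ ^ 2 = C.P k * ‖C.gain R i v k‖ ^ 2 := by
    intro k hk
    simp only [signalVar, errorWeight, Sum.elim_inl, if_neg (Finset.ne_of_mem_erase hk), sub_zero]
  rw [Finset.sum_congr rfl h]
  simp only [signalVar, errorWeight, Sum.elim_inl, Sum.elim_inr, RCLike.norm_conj,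
    ← Finset.mul_sum, if_true]
  ring

lemma residualPower_nonneg (v : CSI nt nr) : 0 ≤ C.residualPower R i v :=
  add_nonneg (Finset.sum_nonneg fun k _ => mul_nonneg (C.P_pos k).le (sq_nonneg _))
    (mul_nonneg C.b_pos.le (Finset.sum_nonneg fun _ _ => sq_nonneg _))

lemma measurable_dotProduct_star {β y : CSI nt nr → Fin nr → ℂ} (hβ : Measurable β)
    (hy : Measurable y) : Measurable fun v => star (β v) ⬝ᵥ y v := by
  refine Finset.measurable_sum _ fun r _ => Measurable.mul ?_ ((measurable_pi_apply r).comp hy)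
  exact Complex.continuous_conj.measurable.comp ((measurable_pi_apply r).comp hβ)

lemma measurable_gain (k : Fin nt) : Measurable fun v => C.gain R i v k := by
  refine ((measurable_dotProduct_star (R.measurable_β i) (measurable_pi_apply k)).const_mul
    _).sub ?_
  split_ifs
  · exact measurable_dotProduct_star (R.measurable_β i) (R.measurable_γ k)
  · exact measurable_const

lemma measurable_conj_β (r : Fin nr) : Measurable fun v => conj (R.β i v r) :=
  Complex.continuous_conj.measurable.comp ((measurable_pi_apply r).comp (R.measurable_β i))

lemma measurable_weight : Measurable (C.weight R i) := by
  refine measurable_pi_lambda _ fun j => ?_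
  rcases j with k | r
  · exact C.measurable_gain R i k
  · exact measurable_conj_β R i r

lemma measurable_errorWeight : Measurable (C.errorWeight R i) := by
  refine measurable_pi_lambda _ fun j => ?_
  rcases j with k | r
  · refine (C.measurable_gain R i k).sub ?_
    split_ifs
    · exact R.measurable_f i
    · exact measurable_const
  · exact measurable_conj_β R i r

lemma measurable_residualPower : Measurable (C.residualPower R i) :=
  (Finset.measurable_sum _ fun k _ => ((C.measurable_gain R i k).norm.pow_const 2).const_mul _).add
    ((Finset.measurable_sum _ fun r _ => (((measurable_pi_apply r).comp
      (R.measurable_β i)).norm.pow_const 2)).const_mul _)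

lemma measurable_g :
    Measurable fun ω => R.g i (C.Y ω) (C.Yp ω) (fun k => C.X ω k) := by
  simp only [g_eq]
  exact Finset.measurable_sum _ fun j _ => ((measurable_pi_apply j).comp
    ((C.measurable_weight R i).comp C.measurable_Yp)).mul (C.measurable_signal j)

lemma measurable_f_Yp : Measurable fun ω => R.f i (C.Yp ω) :=
  (R.measurable_f i).comp C.measurable_Yp

lemma lintegral_error [IsProbabilityMeasure μ] :
    ∫⁻ ω, ENNReal.ofReal (‖R.g i (C.Y ω) (C.Yp ω) (fun k => C.X ω k)
        - R.f i (C.Yp ω) * C.X ω i‖ ^ 2) ∂μ =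
      ∫⁻ ω, ENNReal.ofReal (C.residualPower R i (C.Yp ω)
        + C.P i * ‖C.gain R i (C.Yp ω) i - R.f i (C.Yp ω)‖ ^ 2) ∂μ := by
  have h := lintegral_norm_sq_sum (c := fun _ => 1) C.memLp_signal C.integral_signal_mul_conj
    C.measurable_signal C.measurable_Yp C.indepFun_Yp_signal measurable_const
    (fun _ => zero_le_one) (C.measurable_errorWeight R i)
  simpa only [one_mul, ← error_eq, sum_errorWeight] using h

lemma lintegral_g [IsProbabilityMeasure μ] {θ : ℝ} (hθ : θ < 0) :
    ∫⁻ ω, ENNReal.ofReal (-θ / (1 - θ * C.P i * ‖R.f i (C.Yp ω)‖ ^ 2) *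
        ‖R.g i (C.Y ω) (C.Yp ω) (fun k => C.X ω k)‖ ^ 2) ∂μ =
      ∫⁻ ω, ENNReal.ofReal (-θ / (1 - θ * C.P i * ‖R.f i (C.Yp ω)‖ ^ 2) *
        (C.residualPower R i (C.Yp ω) + C.P i * ‖C.gain R i (C.Yp ω) i‖ ^ 2)) ∂μ := by
  have h := lintegral_norm_sq_sum
    (c := fun v => -θ / (1 - θ * C.P i * ‖R.f i v‖ ^ 2)) C.memLp_signal C.integral_signal_mul_conj
    C.measurable_signal C.measurable_Yp C.indepFun_Yp_signal
    (measurable_const.div ((((R.measurable_f i).norm.pow_const 2).const_mul _).const_sub _))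
    (fun v => div_nonneg (by linarith)
      (by linarith [one_le_one_sub (C.P_pos i) hθ (R.f i v)])) (C.measurable_weight R i)
  simpa only [← g_eq, sum_weight] using h

/-- Subtraction of decoded symbols affects only the gains with `k < i`. Those contribute nonnegative
power and are dropped; the later gains are fixed by `β`. -/
lemma interference_le_residualPower (v : CSI nt nr) :
    ∑ k ∈ Finset.Ioi i, C.a k * ‖star (R.β i v) ⬝ᵥ v k‖ ^ 2 + C.b * ∑ r, ‖R.β i v r‖ ^ 2 ≤
      C.residualPower R i v := by
  refine add_le_add_left ?_ _
  have h : ∀ k ∈ Finset.Ioi i, C.a k * ‖star (R.β i v) ⬝ᵥ v k‖ ^ 2 =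
      C.P k * ‖C.gain R i v k‖ ^ 2 := by
    intro k hk
    rw [gain, if_neg (not_lt.2 (Finset.mem_Ioi.1 hk).le), sub_zero, norm_mul, mul_pow, a_eq,
      mul_assoc]
  rw [Finset.sum_congr rfl h]
  refine Finset.sum_le_sum_of_subset_of_nonneg ?_ fun k _ _ =>
    mul_nonneg (C.P_pos k).le (sq_nonneg _)
  intro k hk
  exact Finset.mem_erase.2 ⟨(Finset.mem_Ioi.1 hk).ne', Finset.mem_univ k⟩

lemma gain_self (v : CSI nt nr) :
    C.gain R i v i = C.mmseCoeff i * (star (R.β i v) ⬝ᵥ v i) := by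
  rw [gain, if_neg (lt_irrefl i), sub_zero]

lemma gmiOf_le [IsProbabilityMeasure μ] :
    C.gmiOf R i ≤ ((∫ ω, C.substreamInfo i ω ∂μ : ℝ) : EReal) := by
  have hs := C.residualPower_nonneg R i
  have hP := C.P_pos i
  have hsm := (C.measurable_residualPower R i).comp C.measurable_Yp
  have hgm := (C.measurable_gain R i i).comp C.measurable_Yp
  have hfm := C.measurable_f_Yp R i
  refine gmi_le hP (C.measurable_g R i) hfm (C.measurable_X_apply i)
    (hsm.add ((hgm.sub hfm).norm.pow_const 2 |>.const_mul _))
    (hsm.add (hgm.norm.pow_const 2 |>.const_mul _))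
    (fun ω => add_nonneg (hs _) (mul_nonneg hP.le (sq_nonneg _)))
    (fun ω => add_nonneg (hs _) (mul_nonneg hP.le (sq_nonneg _)))
    (C.lintegral_error R i) (fun θ hθ => C.lintegral_g R i hθ) (C.integrable_substreamInfo i)
    fun θ hθ ω => ?_
  rw [substreamInfo_eq]
  have hq := quality_nonneg C.a_nonneg C.b_pos (Finset.Ioi i) (C.Yp ω) i
  refine rate_le hP hθ (hs _) (mul_nonneg (C.a_nonneg i) hq) _ _ ?_
  have h := norm_sq_dotProduct_le_quality C.a_nonneg C.b_pos (Finset.Ioi i) (C.Yp ω) i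
    (R.β i (C.Yp ω))
  have h1 := h.trans (mul_le_mul_of_nonneg_right
    (C.interference_le_residualPower R i (C.Yp ω)) hq)
  have h2 := mul_le_mul_of_nonneg_left h1 (C.a_nonneg i)
  simp only [Function.comp_apply]
  calc C.P i * ‖C.gain R i (C.Yp ω) i‖ ^ 2
      = C.a i * ‖star (R.β i (C.Yp ω)) ⬝ᵥ C.Yp ω i‖ ^ 2 := by
        rw [gain_self, norm_mul, mul_pow, a_eq, mul_assoc]
    _ ≤ _ := h2
    _ = _ := by ring

/-- The linear receiver which removes the decoded substreams, treats the remaining ones as noise,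
and applies the normalized MMSE filter. -/
def optimalReceiver : LinearReceiver nt nr where
  β i v := (((√(quality C.a C.b (Finset.Ioi i) v i))⁻¹ : ℝ) : ℂ) •
    mmseFilter C.a C.b (Finset.Ioi i) v i
  γ k v := C.mmseCoeff k • v k
  f i v := C.mmseCoeff i * (√(quality C.a C.b (Finset.Ioi i) v i) : ℝ)
  measurable_β i :=
    (Complex.measurable_ofReal.comp (measurable_quality C.a C.b (Finset.Ioi i) i).sqrt.inv).smul
      (measurable_mmseFilter C.a C.b (Finset.Ioi i) i)
  measurable_γ k := by fun_prop
  measurable_f i :=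
    (Complex.measurable_ofReal.comp
      (measurable_quality C.a C.b (Finset.Ioi i) i).sqrt).const_mul _

lemma star_optimalReceiver_β (v : CSI nt nr) (y : Fin nr → ℂ) :
    star (C.optimalReceiver.β i v) ⬝ᵥ y =
      (((√(quality C.a C.b (Finset.Ioi i) v i))⁻¹ : ℝ) : ℂ) *
        (star (mmseFilter C.a C.b (Finset.Ioi i) v i) ⬝ᵥ y) := by
  simp only [optimalReceiver]
  rw [star_smul, smul_dotProduct, RCLike.star_def, Complex.conj_ofReal, smul_eq_mul]

lemma gain_optimalReceiver_self (v : CSI nt nr) :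
    C.gain C.optimalReceiver i v i = C.optimalReceiver.f i v := by
  have hq := quality_nonneg C.a_nonneg C.b_pos (Finset.Ioi i) v i
  rw [gain_self, star_optimalReceiver_β, star_mmseFilter_dotProduct C.a_nonneg C.b_pos,
    ← Complex.ofReal_mul]
  simp only [optimalReceiver]
  congr 2
  rw [inv_mul_eq_div, Real.div_sqrt]

/-- Decoded substreams cancel exactly, leaving the quadratic form of the scaled MMSE filter. The
value is `1`, except that it is `0` when the quality vanishes, since then `(√0)⁻¹ = 0`. -/
lemma residualPower_optimalReceiver (v : CSI nt nr) :
    C.residualPower C.optimalReceiver i v =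
      (√(quality C.a C.b (Finset.Ioi i) v i))⁻¹ ^ 2 * quality C.a C.b (Finset.Ioi i) v i := by
  set q := quality C.a C.b (Finset.Ioi i) v i with hq
  have h := quadratic_mmseFilter C.a_nonneg C.b_pos (Finset.Ioi i) v i
  rw [← hq] at h
  have hsub : Finset.Ioi i ⊆ Finset.univ.erase i := fun k hk =>
    Finset.mem_erase.2 ⟨(Finset.mem_Ioi.1 hk).ne', Finset.mem_univ k⟩
  have h1 : ∀ k ∈ Finset.Ioi i, C.P k * ‖C.gain C.optimalReceiver i v k‖ ^ 2 =
      (√q)⁻¹ ^ 2 * (C.a k * ‖star (mmseFilter C.a C.b (Finset.Ioi i) v i) ⬝ᵥ v k‖ ^ 2) := by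
    intro k hk
    rw [gain, if_neg (not_lt.2 (Finset.mem_Ioi.1 hk).le), sub_zero, star_optimalReceiver_β, a_eq,
      norm_mul, norm_mul, Complex.norm_real, Real.norm_eq_abs, mul_pow, mul_pow, sq_abs]
    ring
  have h2 : ∀ k ∈ Finset.univ.erase i, k ∉ Finset.Ioi i →
      C.P k * ‖C.gain C.optimalReceiver i v k‖ ^ 2 = 0 := by
    intro k hk hk'
    have hlt : k < i := lt_of_le_of_ne (not_lt.1 fun h => hk' (Finset.mem_Ioi.2 h))
      (Finset.ne_of_mem_erase hk)
    have hγ : C.optimalReceiver.γ k v = C.mmseCoeff k • v k := rfl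
    rw [gain, if_pos hlt, hγ, dotProduct_smul, smul_eq_mul, sub_self]
    simp
  have h3 : ∀ r, ‖C.optimalReceiver.β i v r‖ ^ 2 =
      (√q)⁻¹ ^ 2 * ‖mmseFilter C.a C.b (Finset.Ioi i) v i r‖ ^ 2 := by
    intro r
    simp only [optimalReceiver]
    rw [Pi.smul_apply, smul_eq_mul, norm_mul, Complex.norm_real, Real.norm_eq_abs, mul_pow, sq_abs]
  rw [residualPower, ← Finset.sum_subset hsub h2, Finset.sum_congr rfl h1, ← Finset.mul_sum]
  simp only [h3, ← Finset.mul_sum]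
  rw [← h]
  ring

lemma norm_sq_optimalReceiver_f (v : CSI nt nr) :
    C.P i * ‖C.optimalReceiver.f i v‖ ^ 2 = C.a i * quality C.a C.b (Finset.Ioi i) v i := by
  have hq := quality_nonneg C.a_nonneg C.b_pos (Finset.Ioi i) v i
  simp only [optimalReceiver]
  rw [norm_mul, Complex.norm_real, Real.norm_eq_abs, mul_pow, sq_abs, Real.sq_sqrt hq, a_eq]
  ring

lemma le_gmiOf_optimalReceiver [IsProbabilityMeasure μ] :
    ((∫ ω, C.substreamInfo i ω ∂μ : ℝ) : EReal) ≤ C.gmiOf C.optimalReceiver i := by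
  have hs := C.residualPower_nonneg C.optimalReceiver i
  have hP := C.P_pos i
  have hsm := (C.measurable_residualPower C.optimalReceiver i).comp C.measurable_Yp
  have hgm := (C.measurable_gain C.optimalReceiver i i).comp C.measurable_Yp
  have hfm := C.measurable_f_Yp C.optimalReceiver i
  have hA : ∀ ω, C.residualPower C.optimalReceiver i (C.Yp ω) + C.P i *
      ‖C.gain C.optimalReceiver i (C.Yp ω) i - C.optimalReceiver.f i (C.Yp ω)‖ ^ 2 =
        C.residualPower C.optimalReceiver i (C.Yp ω) := by
    intro ω
    rw [gain_optimalReceiver_self, sub_self]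
    simp
  refine le_gmi hP (C.measurable_g _ i) hfm (C.measurable_X_apply i)
    (hsm.add ((hgm.sub hfm).norm.pow_const 2 |>.const_mul _))
    (hsm.add (hgm.norm.pow_const 2 |>.const_mul _))
    (fun ω => add_nonneg (hs _) (mul_nonneg hP.le (sq_nonneg _)))
    (fun ω => add_nonneg (hs _) (mul_nonneg hP.le (sq_nonneg _)))
    (C.lintegral_error _ i) (fun θ hθ => C.lintegral_g _ i hθ) (C.integrable_substreamInfo i)
    (fun ω => ?_) (fun ω => ?_) (fun ω => ?_)
  · refine (hA ω).trans_le ?_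
    have hq := quality_nonneg C.a_nonneg C.b_pos (Finset.Ioi i) (C.Yp ω) i
    rw [residualPower_optimalReceiver, inv_pow, Real.sq_sqrt hq]
    exact inv_mul_le_one
  · rw [substreamInfo_eq, norm_sq_optimalReceiver_f]
  · refine Eq.trans ?_ (congrArg _ (hA ω).symm)
    have hq := quality_nonneg C.a_nonneg C.b_pos (Finset.Ioi i) (C.Yp ω) i
    simp only [Pi.add_apply, Function.comp_apply]
    rw [gain_optimalReceiver_self, norm_sq_optimalReceiver_f, residualPower_optimalReceiver,
      inv_pow, Real.sq_sqrt hq]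
    -- With zero quality the filter and the scaling are zero, and both sides vanish; otherwise the
    -- residual power is `1` and both sides are `1 + κ`.
    by_cases h0 : quality C.a C.b (Finset.Ioi i) (C.Yp ω) i = 0
    · simp [h0]
    · rw [inv_mul_cancel₀ h0]
      ring

lemma gmiLin_eq [IsProbabilityMeasure μ] :
    C.gmiLin i = ((∫ ω, C.substreamInfo i ω ∂μ : ℝ) : EReal) :=
  le_antisymm (iSup_le fun R => C.gmiOf_le R i)
    ((C.le_gmiOf_optimalReceiver i).trans (le_iSup (fun R => C.gmiOf R i) C.optimalReceiver))

lemma sum_gmiLin [IsProbabilityMeasure μ] :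
    ∑ i, C.gmiLin i = ((∫ ω, C.sumInfo ω ∂μ : ℝ) : EReal) := by
  -- The coercion to `EReal` is moved through the sum termwise; every summand is finite.
  have h : ∀ s : Finset (Fin nt), ∑ i ∈ s, C.gmiLin i =
      ((∑ i ∈ s, ∫ ω, C.substreamInfo i ω ∂μ : ℝ) : EReal) := by
    intro s
    induction s using Finset.induction_on with
    | empty => simp
    | insert i s hi ih =>
      rw [Finset.sum_insert hi, Finset.sum_insert hi, ih, gmiLin_eq, EReal.coe_add]
  rw [h, integral_sumInfo]

end PilotChannel

end SGNNDR

end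

theorem mainTheorem4 {Ω : Type*} [MeasurableSpace Ω] (μ : Measure Ω) [IsProbabilityMeasure μ]
    (nt nr : ℕ) (C : SGNNDR.PilotChannel μ nt nr) :
    -- the optimum is a maximum, attained by one linear receiver for all substreams
    (∃ R : SGNNDR.LinearReceiver nt nr, ∀ i, C.gmiOf R i = C.gmiLin i) ∧
    -- GMI of each substream
    (∀ i, Integrable (C.substreamInfo i) μ ∧
      C.gmiLin i = ((∫ ω, C.substreamInfo i ω ∂μ : ℝ) : EReal)) ∧
    -- sum GMI
    (Integrable C.sumInfo μ ∧
      ∑ i, C.gmiLin i = ((∫ ω, C.sumInfo ω ∂μ : ℝ) : EReal)) ∧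
    -- rate of the conventional scheme
    (∀ᵐ ω ∂μ, C.Kz ω = C.covZtilde ω ∧
      C.Kz ω = (C.b : ℂ) • (1 : Matrix (Fin nr) (Fin nr) ℂ)) ∧
    (Integrable C.conventionalInfo μ ∧
      ∑ i, C.gmiLin i = ((∫ ω, C.conventionalInfo ω ∂μ : ℝ) : EReal)) := by
  refine ⟨⟨C.optimalReceiver, fun i => le_antisymm (le_iSup (fun R => C.gmiOf R i) _) ?_⟩,
    fun i => ⟨C.integrable_substreamInfo i, C.gmiLin_eq i⟩, ⟨C.integrable_sumInfo, C.sum_gmiLin⟩,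
    ?_, C.integrable_sumInfo.congr C.conventionalInfo_ae_eq.symm, ?_⟩
  · rw [C.gmiLin_eq]
    exact C.le_gmiOf_optimalReceiver i
  · filter_upwards [C.Kz_ae_eq, C.covZtilde_ae_eq] with ω h1 h2
    exact ⟨h1.trans h2.symm, h1⟩
  · rw [C.sum_gmiLin, integral_congr_ae C.conventionalInfo_ae_eq]
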